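/- Let $m\ge 2$, $N=2^m$, and equip $\mathbb{F}_2^{2m}$ with the symplectic form $\langle a,b\rangle=\sum_{j=1}^m (a_j b_{m+j}+a_{m+j}b_j)$. For $a\in\mathbb{F}_2^{2m}$ let $$E(a)=i^{\sum_{j} a_j a_{m+j}}\; X_1^{a_1}\cdots X_m^{a_m}\,Z_1^{a_{m+1}}\cdots Z_m^{a_{2m}}$$ be the corresponding Hermitian Pauli operator on $\mathbb{C}^N=(\mathbb{C}^2)^{\otimes m}$ (the exponent of $i$ being computed in $\mathbb{Z}$). The Pauli group is $\{i^kE(a)\}$, and the Clifford group $\mathcal{C}_m$ is its normaliser in $\mathrm{U}(N)$. It acts on the space $\mathcal{B}((\mathbb{C}^N)^{\otimes t})$ of linear operators by the $t$-copy adjoint representation $\mathcal{U}_g(X)=g^{\otimes t}X(g^\dagger)^{\otimes t}$. Put $$|a,a\rangle=\tfrac1N\,E(a)\otimes E(a)\in\mathcal{B}((\mathbb{C}^N)^{\otimes 2}),$$ and, for $\langle a,b\rangle=0$, $$|a,b,a+b\rangle=\tfrac1{\sqrt{N^3}}\,E(a)\otimes E(b)\otimes E(a)E(b)\in\mathcal{B}((\mathbb{C}^N)^{\otimes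 3}),$$ where $E(a)E(b)=\pm E(a+b)$. For $a\ne 0$ define $$|\bar a\rangle=\sqrt{\tfrac2N}\sum_{\substack{h:\ \langle h,a\rangle=0\\ h\neq 0,a}}|a,h,a+h\rangle ,\qquad V_d^{(\mathrm c)}=\mathrm{span}\{|\bar a\rangle : a\neq 0\}.$$ Then: 1. $V_d^{(\mathrm c)}\subseteq \mathrm{span}\{|a,b,a+b\rangle : a,b\neq 0,\ a\neq b,\ \langle a,b\rangle=0\}$, and $V_d^{(\mathrm c)}$ is invariant under the 3-copy adjoint representation of $\mathcal{C}_m$. 2. The diagonal sector $\mathrm{span}\{|a,a\rangle : a\ne 0\}$ is invariant under the 2-copy adjoint representation of $\mathcal{C}_m$, and there is a linear bijection $L$ from the diagonal sector onto $V_d^{(\mathrm c)}$ with $L|a,a\rangle=|\bar a\rangle$ for all $a\neq 0$ that intertwines the two actions of $\mathcal{C}_m$; so the two subrepresentations are isomorphic. 3. $V_d^{(\mathrm c)}$ is the direct sum of three irreducible subrepresentations of $\mathcal{C}_m$, which are pairwise inequivalent. -/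

import Mathlib

open scoped Matrix

/-- The tensor product `⨂ j, A j` of finitely many square matrices, as a matrix indexed by
families of indices: its `(x, y)` entry is `∏ j, A j (x j) (y j)`. -/
def tensorMat {ι n : Type} [Fintype ι] (A : ι → Matrix n n ℂ) :
    Matrix (ι → n) (ι → n) ℂ :=
  Matrix.of fun x y => ∏ j, A j (x j) (y j)

theorem tensorMat_mul {ι n : Type} [Fintype ι] [DecidableEq ι] [Fintype n]
    (A B : ι → Matrix n n ℂ) :
    tensorMat (fun j => A j * B j) = tensorMat A * tensorMat B := by
  ext x y
  simp only [tensorMat, Matrix.of_apply, Matrix.mul_apply]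
  rw [Finset.prod_univ_sum, Fintype.piFinset_univ]
  exact Finset.sum_congr rfl fun z _ => Finset.prod_mul_distrib

theorem tensorMat_one {ι n : Type} [Fintype ι] [DecidableEq n] :
    tensorMat (fun _ : ι => (1 : Matrix n n ℂ)) = 1 := by
  ext x y
  simp only [tensorMat, Matrix.of_apply, Matrix.one_apply]
  rw [Finset.prod_ite_zero]
  simp [funext_iff]

/-- Computational basis labels of `m` qubits; there are `N = 2 ^ m` of them. -/
abbrev Qubits (m : ℕ) : Type := Fin m → Fin 2

/-- `𝔽₂^{2m}`: the left half of the coordinates is the `X` part, the right half the `Z` part. -/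
abbrev PauliLabel (m : ℕ) : Type := Fin m ⊕ Fin m → ZMod 2

/-- The symplectic form `⟨a, b⟩ = aᵀ Ω b` on `𝔽₂^{2m}`. -/
def symp {m : ℕ} (a b : PauliLabel m) : ZMod 2 :=
  a ⬝ᵥ (Matrix.fromBlocks 0 1 1 0 : Matrix (Fin m ⊕ Fin m) (Fin m ⊕ Fin m) (ZMod 2)) *ᵥ b

/-- The single-qubit Pauli matrix `X`. -/
def pauliX : Matrix (Fin 2) (Fin 2) ℂ := !![0, 1; 1, 0]

/-- The single-qubit Pauli matrix `Z`. -/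
def pauliZ : Matrix (Fin 2) (Fin 2) ℂ := !![1, 0; 0, -1]

/-- The self-adjoint Pauli operator `E(a) = i^{a_X · a_Z} X(a_X) Z(a_Z)` on `m` qubits (the
exponent `a_X · a_Z` being computed in `ℤ`), written as a tensor product over the qubits. -/
noncomputable def pauli {m : ℕ} (a : PauliLabel m) : Matrix (Qubits m) (Qubits m) ℂ :=
  tensorMat fun j : Fin m =>
    Complex.I ^ ((a (Sum.inl j)).val * (a (Sum.inr j)).val) •
      (pauliX ^ (a (Sum.inl j)).val * pauliZ ^ (a (Sum.inr j)).val)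

/-- The `m`-qubit Pauli group, i.e. the group of all `i ^ k E(a)`, inside the unitary group. -/
noncomputable def pauliGroup (m : ℕ) : Subgroup (Matrix.unitaryGroup (Qubits m) ℂ) :=
  Subgroup.closure {U | ∃ (k : ℕ) (a : PauliLabel m),
    (U : Matrix (Qubits m) (Qubits m) ℂ) = Complex.I ^ k • pauli a}

/-- The Clifford group: the normaliser of the Pauli group in the unitary group. -/
noncomputable def cliffordGroup (m : ℕ) : Subgroup (Matrix.unitaryGroup (Qubits m) ℂ) :=
  Subgroup.normalizer (pauliGroup m : Set (Matrix.unitaryGroup (Qubits m) ℂ))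

/-- Linear operators on `t` copies of `m` qubits. -/
abbrev CopyOp (m t : ℕ) : Type := Matrix (Fin t → Qubits m) (Fin t → Qubits m) ℂ

/-- The `t`-copy adjoint representation of the unitary group,
`X ↦ U^{⊗ t} X (U†)^{⊗ t}`. -/
noncomputable def unitaryAdjointRep (m t : ℕ) :
    Representation ℂ (Matrix.unitaryGroup (Qubits m) ℂ) (CopyOp m t) where
  toFun U :=
    { toFun := fun X =>
        tensorMat (fun _ : Fin t => (U : Matrix (Qubits m) (Qubits m) ℂ)) * X *
          tensorMat (fun _ : Fin t => (U : Matrix (Qubits m) (Qubits m) ℂ)ᴴ)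
      map_add' := fun X Y => by rw [mul_add, add_mul]
      map_smul' := fun c X => by simp }
  map_one' := by
    ext1 X
    simp [tensorMat_one]
  map_mul' U V := by
    ext1 X
    simp [tensorMat_mul, mul_assoc]

/-- The `t`-copy adjoint representation of the Clifford group. -/
noncomputable def adjointRep (m t : ℕ) : Representation ℂ (cliffordGroup m) (CopyOp m t) :=
  (unitaryAdjointRep m t).comp (cliffordGroup m).subtype

/-- The normalised tensor product `N^{-t/2} A₁ ⊗ ⋯ ⊗ A_t` with `N = 2 ^ m`. -/
noncomputable def normTensor {m t : ℕ} (A : Fin t → Matrix (Qubits m) (Qubits m) ℂ) :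
    CopyOp m t :=
  (((Real.sqrt (((2 : ℝ) ^ m) ^ t))⁻¹ : ℝ) : ℂ) • tensorMat A

/-- The Pauli basis vector `|a, a⟩` of the operators on two copies. -/
noncomputable def ketPair {m : ℕ} (a : PauliLabel m) : CopyOp m 2 :=
  normTensor ![pauli a, pauli a]

/-- The Pauli basis vector `|a, b, a + b⟩` of the operators on three copies. Its sign is chosen so
that the last tensor factor is `E(a) E(b)`, which is a phase times `E(a + b)`; the prefactor
`i ^ ⟨a, b⟩` makes the vector a Hermitian operator and is `1` when `⟨a, b⟩ = 0`. With this choice a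
Clifford unitary permutes these vectors without signs. -/
noncomputable def ketTriple {m : ℕ} (a b : PauliLabel m) : CopyOp m 3 :=
  Complex.I ^ (symp a b).val • normTensor ![pauli a, pauli b, pauli a * pauli b]

/-- The diagonal sector of the two-copy adjoint representation, `span {|a, a⟩ : a ≠ 0}`. -/
noncomputable def diagonalSector (m : ℕ) : Submodule ℂ (CopyOp m 2) :=
  Submodule.span ℂ {x | ∃ a : PauliLabel m, a ≠ 0 ∧ x = ketPair a}

theorem ketPair_mem_diagonalSector {m : ℕ} {a : PauliLabel m} (ha : a ≠ 0) :
    ketPair a ∈ diagonalSector m :=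
  Submodule.subset_span ⟨a, ha, rfl⟩

/-- The commuting sector `span {|a, b, a + b⟩ : a, b ≠ 0, a ≠ b, ⟨a, b⟩ = 0}`. -/
noncomputable def commutingSector (m : ℕ) : Submodule ℂ (CopyOp m 3) :=
  Submodule.span ℂ {x | ∃ a b : PauliLabel m,
    a ≠ 0 ∧ b ≠ 0 ∧ symp a b = 0 ∧ a ≠ b ∧ x = ketTriple a b}

/-- `|ā⟩ = √(2 / N) ∑_{h : ⟨h, a⟩ = 0, h ≠ 0, a} |a, h, a + h⟩`. -/
noncomputable def ketBar {m : ℕ} (a : PauliLabel m) : CopyOp m 3 :=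
  ((Real.sqrt (2 / (2 : ℝ) ^ m) : ℝ) : ℂ) •
    ∑ h : PauliLabel m with symp h a = 0 ∧ h ≠ 0 ∧ h ≠ a, ketTriple a h

/-- `V_d^{(c)} = span {|ā⟩ : a ≠ 0}`. -/
noncomputable def commutingDiagonal (m : ℕ) : Submodule ℂ (CopyOp m 3) :=
  Submodule.span ℂ {x | ∃ a : PauliLabel m, a ≠ 0 ∧ x = ketBar a}

section Tensor

variable {ι n : Type} [Fintype ι]

theorem tensorMat_smul (c : ι → ℂ) (A : ι → Matrix n n ℂ) :
    tensorMat (fun j => c j • A j) = (∏ j, c j) • tensorMat A := by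
  ext x y
  simp [tensorMat, Finset.prod_mul_distrib]

theorem conjTranspose_tensorMat (A : ι → Matrix n n ℂ) :
    (tensorMat A)ᴴ = tensorMat fun j => (A j)ᴴ := by
  ext x y
  simp [tensorMat, Matrix.conjTranspose_apply]

theorem trace_tensorMat [DecidableEq ι] [Fintype n] (A : ι → Matrix n n ℂ) :
    (tensorMat A).trace = ∏ j, (A j).trace := by
  simp only [Matrix.trace, Matrix.diag_apply, tensorMat, Matrix.of_apply]
  rw [Finset.prod_univ_sum, Fintype.piFinset_univ]

end Tensor

theorem zmod_two_cases (s : ZMod 2) : s = 0 ∨ s = 1 := by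
  revert s
  decide

/-- The nontrivial character `s ↦ (-1) ^ s` of `ZMod 2`. -/
noncomputable def signChar : AddChar (ZMod 2) ℂ where
  toFun s := (-1) ^ s.val
  map_zero_eq_one' := by simp
  map_add_eq_mul' := by
    intro a b
    have h11 : (1 : ZMod 2) + 1 = 0 := rfl
    rcases zmod_two_cases a with rfl | rfl <;> rcases zmod_two_cases b with rfl | rfl <;>
      simp [ZMod.val_one, h11]

theorem signChar_apply (s : ZMod 2) : signChar s = (-1) ^ s.val := rfl

@[simp] theorem signChar_one : signChar 1 = -1 := by simp [signChar_apply, ZMod.val_one]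

theorem signChar_sum {ι : Type} (s : Finset ι) (f : ι → ZMod 2) :
    signChar (∑ j ∈ s, f j) = ∏ j ∈ s, signChar (f j) :=
  map_prod signChar.toMonoidHom (fun j => Multiplicative.ofAdd (f j)) s

theorem signChar_injective : Function.Injective signChar := by
  intro s t h
  rcases zmod_two_cases s with rfl | rfl <;> rcases zmod_two_cases t with rfl | rfl <;>
    simp at h ⊢ <;> norm_num at h

/-- The single-qubit self-adjoint Pauli operator with label `(x, z)`. -/
noncomputable def qubitPauli (x z : ZMod 2) : Matrix (Fin 2) (Fin 2) ℂ :=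
  Complex.I ^ (x.val * z.val) • (pauliX ^ x.val * pauliZ ^ z.val)

theorem qubitPauli_mul (x z x' z' : ZMod 2) : ∃ k : ℕ,
    qubitPauli x z * qubitPauli x' z' = Complex.I ^ k • qubitPauli (x + x') (z + z') := by
  have h3 : Complex.I ^ 3 = -Complex.I := by rw [pow_succ, Complex.I_sq]; ring
  have h11 : (1 : ZMod 2) + 1 = 0 := rfl
  rcases zmod_two_cases x with rfl | rfl <;> rcases zmod_two_cases z with rfl | rfl <;>
  rcases zmod_two_cases x' with rfl | rfl <;> rcases zmod_two_cases z' with rfl | rfl <;>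
  first
  | (refine ⟨0, ?_⟩
     simp [qubitPauli, pauliX, pauliZ, ZMod.val_one, h11, Matrix.one_fin_two]
     done)
  | (refine ⟨1, ?_⟩
     simp [qubitPauli, pauliX, pauliZ, ZMod.val_one, h11, Matrix.one_fin_two]
     done)
  | (refine ⟨3, ?_⟩
     simp [qubitPauli, pauliX, pauliZ, ZMod.val_one, h11, h3, Matrix.one_fin_two])

theorem qubitPauli_comm (x z x' z' : ZMod 2) :
    qubitPauli x z * qubitPauli x' z' =
      signChar (x * z' + z * x') • (qubitPauli x' z' * qubitPauli x z) := by
  have h11 : (1 : ZMod 2) + 1 = 0 := rfl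
  rcases zmod_two_cases x with rfl | rfl <;> rcases zmod_two_cases z with rfl | rfl <;>
  rcases zmod_two_cases x' with rfl | rfl <;> rcases zmod_two_cases z' with rfl | rfl <;>
  simp [qubitPauli, pauliX, pauliZ, ZMod.val_one, h11, Matrix.one_fin_two]

theorem conjTranspose_qubitPauli (x z : ZMod 2) : (qubitPauli x z)ᴴ = qubitPauli x z := by
  rcases zmod_two_cases x with rfl | rfl <;> rcases zmod_two_cases z with rfl | rfl <;>
  (ext i j
   fin_cases i <;> fin_cases j <;>
     simp [qubitPauli, pauliX, pauliZ, ZMod.val_one, Matrix.conjTranspose_apply])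

theorem qubitPauli_mul_self (x z : ZMod 2) : qubitPauli x z * qubitPauli x z = 1 := by
  rcases zmod_two_cases x with rfl | rfl <;> rcases zmod_two_cases z with rfl | rfl <;>
  simp [qubitPauli, pauliX, pauliZ, ZMod.val_one, Matrix.one_fin_two]

theorem qubitPauli_zero : qubitPauli 0 0 = 1 := by simp [qubitPauli]

theorem trace_qubitPauli {x z : ZMod 2} (h : x ≠ 0 ∨ z ≠ 0) : (qubitPauli x z).trace = 0 := by
  rcases zmod_two_cases x with rfl | rfl <;> rcases zmod_two_cases z with rfl | rfl <;>
  simp [qubitPauli, pauliX, pauliZ, ZMod.val_one, Matrix.trace_fin_two] at h ⊢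

section Pauli

variable {m : ℕ}

theorem pauli_eq (a : PauliLabel m) :
    pauli a = tensorMat fun j => qubitPauli (a (Sum.inl j)) (a (Sum.inr j)) := rfl

theorem symp_eq_sum (a b : PauliLabel m) :
    symp a b = ∑ j, (a (Sum.inl j) * b (Sum.inr j) + a (Sum.inr j) * b (Sum.inl j)) := by
  simp [symp, dotProduct, Matrix.mulVec, Matrix.fromBlocks, Fintype.sum_sum_type,
    Matrix.one_apply, Finset.sum_add_distrib]

theorem symp_comm (a b : PauliLabel m) : symp a b = symp b a := by
  rw [symp_eq_sum, symp_eq_sum]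
  exact Finset.sum_congr rfl fun j _ => by ring

@[simp] theorem symp_add_left (a b c : PauliLabel m) : symp (a + b) c = symp a c + symp b c := by
  simp only [symp, add_dotProduct]

@[simp] theorem symp_add_right (a b c : PauliLabel m) : symp a (b + c) = symp a b + symp a c := by
  rw [symp_comm, symp_add_left, symp_comm b, symp_comm c]

@[simp] theorem symp_zero_left (a : PauliLabel m) : symp 0 a = 0 := by simp [symp]

@[simp] theorem symp_zero_right (a : PauliLabel m) : symp a 0 = 0 := by simp [symp]

@[simp] theorem symp_self (a : PauliLabel m) : symp a a = 0 := by
  rw [symp_eq_sum]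
  refine Finset.sum_eq_zero fun j _ => ?_
  rw [mul_comm (a (Sum.inr j)), CharTwo.add_self_eq_zero]

theorem pauli_mul (a b : PauliLabel m) :
    ∃ k : ℕ, pauli a * pauli b = Complex.I ^ k • pauli (a + b) := by
  choose k hk using fun j : Fin m =>
    qubitPauli_mul (a (Sum.inl j)) (a (Sum.inr j)) (b (Sum.inl j)) (b (Sum.inr j))
  refine ⟨∑ j, k j, ?_⟩
  rw [pauli_eq, pauli_eq, pauli_eq, ← tensorMat_mul, ← Finset.prod_pow_eq_pow_sum,
    ← tensorMat_smul]
  simp only [hk, Pi.add_apply]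

theorem pauli_comm (a b : PauliLabel m) :
    pauli a * pauli b = signChar (symp a b) • (pauli b * pauli a) := by
  rw [symp_eq_sum, signChar_sum, pauli_eq, pauli_eq, ← tensorMat_mul, ← tensorMat_mul,
    ← tensorMat_smul]
  simp only [← qubitPauli_comm]

theorem conjTranspose_pauli (a : PauliLabel m) : (pauli a)ᴴ = pauli a := by
  rw [pauli_eq, conjTranspose_tensorMat]
  simp only [conjTranspose_qubitPauli]

@[simp] theorem pauli_mul_self (a : PauliLabel m) : pauli a * pauli a = 1 := by
  rw [pauli_eq, ← tensorMat_mul]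
  simp only [qubitPauli_mul_self, tensorMat_one]

@[simp] theorem pauli_zero : pauli (0 : PauliLabel m) = 1 := by
  rw [pauli_eq]
  simp only [Pi.zero_apply, qubitPauli_zero, tensorMat_one]

theorem trace_pauli {a : PauliLabel m} (ha : a ≠ 0) : (pauli a).trace = 0 := by
  obtain ⟨j, hj⟩ := Function.ne_iff.mp ha
  rw [pauli_eq, trace_tensorMat]
  rcases j with j | j
  · exact Finset.prod_eq_zero (Finset.mem_univ j) (trace_qubitPauli (Or.inl hj))
  · exact Finset.prod_eq_zero (Finset.mem_univ j) (trace_qubitPauli (Or.inr hj))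

theorem pauli_ne_zero (a : PauliLabel m) : pauli a ≠ 0 := by
  intro h
  have := pauli_mul_self a
  rw [h, mul_zero] at this
  exact zero_ne_one this

theorem add_label_self (a : PauliLabel m) : a + a = 0 := by
  ext j
  exact CharTwo.add_self_eq_zero _

theorem add_label_eq_zero_iff {a b : PauliLabel m} : a + b = 0 ↔ a = b := by
  constructor
  · intro h
    have := congrArg (· + b) h
    simpa [add_assoc, add_label_self] using this
  · rintro rfl
    exact add_label_self a

theorem trace_pauli_mul_of_ne {a b : PauliLabel m} (h : a ≠ b) :
    (pauli a * pauli b).trace = 0 := by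
  obtain ⟨k, hk⟩ := pauli_mul a b
  rw [hk, Matrix.trace_smul, trace_pauli (mt add_label_eq_zero_iff.mp h), smul_zero]

theorem trace_pauli_mul_self (a : PauliLabel m) : (pauli a * pauli a).trace = 2 ^ m := by
  simp [Matrix.trace_one]

theorem pauli_label_eq {a b : PauliLabel m} {c : ℂ} (h : pauli a = c • pauli b) : a = b := by
  by_contra hab
  have h1 := trace_pauli_mul_self a
  nth_rewrite 2 [h] at h1
  rw [Matrix.mul_smul, Matrix.trace_smul, trace_pauli_mul_of_ne hab, smul_zero] at h1
  exact pow_ne_zero m two_ne_zero h1.symm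

end Pauli

section Clifford

variable {m : ℕ}

/-- The Pauli operator `E(a)` as an element of the unitary group. -/
noncomputable def pauliUnitary (a : PauliLabel m) : Matrix.unitaryGroup (Qubits m) ℂ :=
  ⟨pauli a, by
    rw [Matrix.mem_unitaryGroup_iff, Matrix.star_eq_conjTranspose, conjTranspose_pauli,
      pauli_mul_self]⟩

theorem mem_pauliGroup_iff {U : Matrix.unitaryGroup (Qubits m) ℂ} :
    U ∈ pauliGroup m ↔ ∃ (k : ℕ) (a : PauliLabel m),
      (U : Matrix (Qubits m) (Qubits m) ℂ) = Complex.I ^ k • pauli a := by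
  refine ⟨fun hU => ?_, fun hU => Subgroup.subset_closure hU⟩
  induction hU using Subgroup.closure_induction with
  | mem U hU => exact hU
  | one => exact ⟨0, 0, by simp⟩
  | mul U V _ _ hU hV =>
    obtain ⟨k, a, hk⟩ := hU
    obtain ⟨l, b, hl⟩ := hV
    obtain ⟨r, hr⟩ := pauli_mul a b
    refine ⟨k + l + r, a + b, ?_⟩
    simp only [Submonoid.coe_mul, hk, hl, Matrix.smul_mul, Matrix.mul_smul, hr, smul_smul]
    congr 1
    ring
  | inv U _ hU =>
    obtain ⟨k, a, hk⟩ := hU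
    refine ⟨3 * k, a, ?_⟩
    rw [Matrix.UnitaryGroup.inv_val, hk, Matrix.star_eq_conjTranspose,
      Matrix.conjTranspose_smul, conjTranspose_pauli, pow_mul, star_pow]
    congr 2
    rw [pow_succ, Complex.I_sq]
    simp

theorem mem_cliffordGroup_iff {g : Matrix.unitaryGroup (Qubits m) ℂ} :
    g ∈ cliffordGroup m ↔ ∀ U, U ∈ pauliGroup m ↔ g * U * g⁻¹ ∈ pauliGroup m :=
  Subgroup.mem_normalizer_iff

theorem conjTranspose_mul_self_unitary (g : Matrix.unitaryGroup (Qubits m) ℂ) :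
    (g : Matrix (Qubits m) (Qubits m) ℂ)ᴴ * (g : Matrix (Qubits m) (Qubits m) ℂ) = 1 :=
  Matrix.UnitaryGroup.star_mul_self g

theorem conj_mul_conj (g : Matrix.unitaryGroup (Qubits m) ℂ)
    (A B : Matrix (Qubits m) (Qubits m) ℂ) :
    (g : Matrix (Qubits m) (Qubits m) ℂ) * A * (g : Matrix (Qubits m) (Qubits m) ℂ)ᴴ *
      ((g : Matrix (Qubits m) (Qubits m) ℂ) * B * (g : Matrix (Qubits m) (Qubits m) ℂ)ᴴ) =
    (g : Matrix (Qubits m) (Qubits m) ℂ) * (A * B) *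
      (g : Matrix (Qubits m) (Qubits m) ℂ)ᴴ := by
  simp only [Matrix.mul_assoc]
  rw [← Matrix.mul_assoc (g : Matrix (Qubits m) (Qubits m) ℂ)ᴴ, conjTranspose_mul_self_unitary,
    Matrix.one_mul]

theorem exists_conj_pauli (g : cliffordGroup m) (a : PauliLabel m) :
    ∃ (b : PauliLabel m) (s : ℂ), s * s = 1 ∧
      (g.1 : Matrix (Qubits m) (Qubits m) ℂ) * pauli a *
        (g.1 : Matrix (Qubits m) (Qubits m) ℂ)ᴴ = s • pauli b := by
  have ha : pauliUnitary a ∈ pauliGroup m :=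
    mem_pauliGroup_iff.mpr ⟨0, a, by simp [pauliUnitary]⟩
  obtain ⟨k, b, hb⟩ := mem_pauliGroup_iff.mp ((mem_cliffordGroup_iff.mp g.2 _).mp ha)
  have hb' : (g.1 : Matrix (Qubits m) (Qubits m) ℂ) * pauli a *
      (g.1 : Matrix (Qubits m) (Qubits m) ℂ)ᴴ = Complex.I ^ k • pauli b := hb
  refine ⟨b, Complex.I ^ k, ?_, hb'⟩
  have hsq := conj_mul_conj g.1 (pauli a) (pauli a)
  rw [hb', pauli_mul_self, Matrix.smul_mul, Matrix.mul_smul, pauli_mul_self, smul_smul]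
    at hsq
  have h1 : (g.1 : Matrix (Qubits m) (Qubits m) ℂ) * 1 *
      (g.1 : Matrix (Qubits m) (Qubits m) ℂ)ᴴ = 1 := by
    rw [Matrix.mul_one]
    exact Matrix.mem_unitaryGroup_iff.mp g.1.2
  rw [h1] at hsq
  have h00 := congrFun (congrFun hsq 0) 0
  simpa using h00

/-- The label `b` with `g E(a) g† = ± E(b)`. -/
noncomputable def conjLabel (g : cliffordGroup m) (a : PauliLabel m) : PauliLabel m :=
  (exists_conj_pauli g a).choose

theorem conj_pauli (g : cliffordGroup m) (a : PauliLabel m) : ∃ s : ℂ, s * s = 1 ∧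
    (g.1 : Matrix (Qubits m) (Qubits m) ℂ) * pauli a *
      (g.1 : Matrix (Qubits m) (Qubits m) ℂ)ᴴ = s • pauli (conjLabel g a) :=
  (exists_conj_pauli g a).choose_spec

theorem conjLabel_eq {g : cliffordGroup m} {a b : PauliLabel m} {s : ℂ}
    (h : (g.1 : Matrix (Qubits m) (Qubits m) ℂ) * pauli a *
      (g.1 : Matrix (Qubits m) (Qubits m) ℂ)ᴴ = s • pauli b) : conjLabel g a = b := by
  obtain ⟨t, ht, h'⟩ := conj_pauli g a
  refine pauli_label_eq (c := t * s) ?_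
  rw [← smul_smul, ← h, h', smul_smul, ht, one_smul]

/-- The permutation of the Pauli labels induced by a Clifford unitary. -/
noncomputable def cliffordPerm (m : ℕ) : cliffordGroup m →* Equiv.Perm (PauliLabel m) :=
  MonoidHom.toHomPerm
    { toFun := fun g => (conjLabel g : Function.End (PauliLabel m))
      map_one' := by
        funext a
        exact conjLabel_eq (s := 1) (b := a) (by simp)
      map_mul' := by
        intro g h
        funext a
        obtain ⟨s, -, hs⟩ := conj_pauli h a
        obtain ⟨t, -, ht⟩ := conj_pauli g (conjLabel h a)
        refine conjLabel_eq (s := s * t) ?_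
        have : ((g * h : cliffordGroup m).1 : Matrix (Qubits m) (Qubits m) ℂ) * pauli a *
            ((g * h : cliffordGroup m).1 : Matrix (Qubits m) (Qubits m) ℂ)ᴴ =
            (g.1 : Matrix (Qubits m) (Qubits m) ℂ) *
            ((h.1 : Matrix (Qubits m) (Qubits m) ℂ) * pauli a *
              (h.1 : Matrix (Qubits m) (Qubits m) ℂ)ᴴ) *
            (g.1 : Matrix (Qubits m) (Qubits m) ℂ)ᴴ := by
          simp [Matrix.mul_assoc, Matrix.conjTranspose_mul]
        rw [this, hs, Matrix.mul_smul, Matrix.smul_mul, ht, smul_smul]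
        rfl }

theorem cliffordPerm_apply (g : cliffordGroup m) (a : PauliLabel m) :
    cliffordPerm m g a = conjLabel g a := rfl

@[simp] theorem cliffordPerm_zero (g : cliffordGroup m) : cliffordPerm m g 0 = 0 := by
  refine conjLabel_eq (s := 1) ?_
  rw [pauli_zero, Matrix.mul_one, one_smul]
  exact Matrix.mem_unitaryGroup_iff.mp g.1.2

theorem cliffordPerm_ne_zero (g : cliffordGroup m) {a : PauliLabel m} (ha : a ≠ 0) :
    cliffordPerm m g a ≠ 0 := by
  rw [← cliffordPerm_zero g]
  exact (cliffordPerm m g).injective.ne ha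

theorem symp_cliffordPerm (g : cliffordGroup m) (a b : PauliLabel m) :
    symp (cliffordPerm m g a) (cliffordPerm m g b) = symp a b := by
  obtain ⟨s, hs, ha⟩ := conj_pauli g a
  obtain ⟨t, ht, hb⟩ := conj_pauli g b
  have h1 := conj_mul_conj g.1 (pauli a) (pauli b)
  have h2 := conj_mul_conj g.1 (pauli b) (pauli a)
  rw [pauli_comm a b, Matrix.mul_smul, Matrix.smul_mul, ← h2, ha, hb] at h1
  simp only [Matrix.smul_mul, Matrix.mul_smul, smul_smul] at h1
  rw [pauli_comm (conjLabel g a), smul_smul] at h1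
  have hne : pauli (conjLabel g b) * pauli (conjLabel g a) ≠ 0 := by
    intro h
    have := congrArg (pauli (conjLabel g b) * ·) h
    simp only [← Matrix.mul_assoc, pauli_mul_self, Matrix.one_mul, Matrix.mul_zero] at this
    exact pauli_ne_zero _ this
  have h3 := smul_left_injective ℂ hne h1
  apply signChar_injective
  rw [cliffordPerm_apply, cliffordPerm_apply]
  have hst : t * s * (s * t) = 1 := by linear_combination t * t * hs + ht
  linear_combination (t * s) * h3 +
    (signChar (symp a b) - signChar (symp (conjLabel g a) (conjLabel g b))) * hst

/-- The matrix `(1 + i Q) / √2`, which is unitary when `Q` is a self-adjoint involution. -/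
noncomputable def pauliRotation (Q : Matrix (Qubits m) (Qubits m) ℂ) :
    Matrix (Qubits m) (Qubits m) ℂ :=
  (((Real.sqrt 2)⁻¹ : ℝ) : ℂ) • (1 + Complex.I • Q)

theorem inv_sqrt_two_mul_self :
    (((Real.sqrt 2)⁻¹ : ℝ) : ℂ) * (((Real.sqrt 2)⁻¹ : ℝ) : ℂ) = 1 / 2 := by
  rw [← Complex.ofReal_mul, ← mul_inv, Real.mul_self_sqrt (by norm_num)]
  norm_num

theorem rotation_mul_neg {Q : Matrix (Qubits m) (Qubits m) ℂ} (hQ : Q * Q = 1) :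
    pauliRotation Q * pauliRotation (-Q) = 1 := by
  have : (1 + Complex.I • Q) * (1 + Complex.I • -Q) = (2 : ℂ) • 1 := by
    simp only [add_mul, mul_add, Matrix.smul_mul, Matrix.mul_smul, smul_smul, Matrix.mul_neg, hQ,
      Complex.I_mul_I, Matrix.one_mul, Matrix.mul_one, smul_neg]
    module
  rw [pauliRotation, pauliRotation, Matrix.smul_mul, Matrix.mul_smul, smul_smul, inv_sqrt_two_mul_self,
    this, smul_smul]
  norm_num

theorem rotation_conj_of_commute {Q A : Matrix (Qubits m) (Qubits m) ℂ} (hQ : Q * Q = 1)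
    (h : Q * A = A * Q) : pauliRotation Q * A * pauliRotation (-Q) = A := by
  have : pauliRotation Q * A = A * pauliRotation Q := by
    simp only [pauliRotation, Matrix.smul_mul, Matrix.mul_smul, add_mul, mul_add, h, Matrix.one_mul,
      Matrix.mul_one]
  rw [this, Matrix.mul_assoc, rotation_mul_neg hQ, Matrix.mul_one]

theorem rotation_conj_of_anticommute {Q A : Matrix (Qubits m) (Qubits m) ℂ} (hQ : Q * Q = 1)
    (h : Q * A = -(A * Q)) : pauliRotation Q * A * pauliRotation (-Q) = Complex.I • (Q * A) := by
  have h1 : A * pauliRotation (-Q) = pauliRotation Q * A := by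
    simp only [pauliRotation, Matrix.smul_mul, Matrix.mul_smul, add_mul, mul_add, h, Matrix.one_mul,
      Matrix.mul_one, Matrix.mul_neg]
  have h2 : (1 + Complex.I • Q) * (1 + Complex.I • Q) = (2 * Complex.I) • Q := by
    simp only [add_mul, mul_add, Matrix.smul_mul, Matrix.mul_smul, smul_smul, hQ,
      Complex.I_mul_I, Matrix.one_mul, Matrix.mul_one]
    module
  have h3 : pauliRotation Q * pauliRotation Q = Complex.I • Q := by
    rw [pauliRotation, Matrix.smul_mul, Matrix.mul_smul, smul_smul, inv_sqrt_two_mul_self, h2,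
      smul_smul]
    congr 1
    ring
  rw [Matrix.mul_assoc, h1, ← Matrix.mul_assoc, h3, Matrix.smul_mul]

/-- The transvection `a ↦ a + ⟨a, h⟩ h`. -/
def transvect (h a : PauliLabel m) : PauliLabel m := a + symp a h • h

theorem rotation_conj_pauli (h a : PauliLabel m) {e : ℂ} (he : e * e = 1) : ∃ c : ℂ,
    (c = 1 ∨ c = e * Complex.I) ∧ ∃ l : ℕ,
    pauliRotation (e • pauli h) * pauli a * pauliRotation (-(e • pauli h)) =
      (c * Complex.I ^ l) • pauli (transvect h a) := by
  have hQ : (e • pauli h) * (e • pauli h) = 1 := by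
    rw [Matrix.smul_mul, Matrix.mul_smul, smul_smul, he, pauli_mul_self, one_smul]
  have hc := pauli_comm h a
  rw [symp_comm] at hc
  rcases zmod_two_cases (symp a h) with h0 | h1
  · refine ⟨1, Or.inl rfl, 0, ?_⟩
    rw [h0, AddChar.map_zero_eq_one, one_smul] at hc
    rw [rotation_conj_of_commute (A := pauli a) hQ (by rw [Matrix.smul_mul, hc, Matrix.mul_smul]), transvect, h0]
    simp
  · rw [h1, signChar_one, neg_one_smul] at hc
    obtain ⟨l, hl⟩ := pauli_mul h a
    refine ⟨_, Or.inr rfl, l, ?_⟩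
    rw [rotation_conj_of_anticommute (A := pauli a) hQ
      (by rw [Matrix.smul_mul, hc, Matrix.mul_smul, smul_neg]), transvect, h1, one_smul,
      Matrix.smul_mul, hl, smul_smul, smul_smul, add_comm a h]
    congr 1
    ring

theorem conjTranspose_rotation_pauli (h : PauliLabel m) :
    (pauliRotation (pauli h))ᴴ = pauliRotation (-pauli h) := by
  simp [pauliRotation, Matrix.conjTranspose_smul, conjTranspose_pauli]

/-- The unitary `(1 + i E(h)) / √2`. -/
noncomputable def rotationUnitary (h : PauliLabel m) : Matrix.unitaryGroup (Qubits m) ℂ :=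
  ⟨pauliRotation (pauli h), by
    rw [Matrix.mem_unitaryGroup_iff, Matrix.star_eq_conjTranspose, conjTranspose_rotation_pauli,
      rotation_mul_neg (pauli_mul_self h)]⟩

theorem rotationUnitary_mem (h : PauliLabel m) : rotationUnitary h ∈ cliffordGroup m := by
  have key : ∀ e : ℂ, (e = 1 ∨ e = -1) → ∀ V W U : Matrix.unitaryGroup (Qubits m) ℂ,
      (V : Matrix (Qubits m) (Qubits m) ℂ) = pauliRotation (e • pauli h) →
      (W : Matrix (Qubits m) (Qubits m) ℂ) = pauliRotation (-(e • pauli h)) →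
      U ∈ pauliGroup m → V * U * W ∈ pauliGroup m := by
    intro e he V W U hV hW hU
    obtain ⟨k, a, hk⟩ := mem_pauliGroup_iff.mp hU
    have hee : e * e = 1 := by rcases he with rfl | rfl <;> norm_num
    obtain ⟨c, hc, l, hl⟩ := rotation_conj_pauli h a hee
    have hcI : ∃ r : ℕ, c = Complex.I ^ r := by
      rcases hc with rfl | rfl
      · exact ⟨0, by simp⟩
      · rcases he with rfl | rfl
        · exact ⟨1, by simp⟩
        · exact ⟨3, by rw [pow_succ, Complex.I_sq]⟩
    obtain ⟨r, rfl⟩ := hcI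
    refine mem_pauliGroup_iff.mpr ⟨k + (r + l), transvect h a, ?_⟩
    simp only [Submonoid.coe_mul, hV, hW, hk, Matrix.mul_smul, Matrix.smul_mul, hl, smul_smul]
    congr 1
    ring
  have h1 : (rotationUnitary h : Matrix (Qubits m) (Qubits m) ℂ) = pauliRotation (pauli h) := rfl
  have h2 : ((rotationUnitary h)⁻¹ : Matrix.unitaryGroup (Qubits m) ℂ).1 =
      pauliRotation (-pauli h) := by
    rw [Matrix.UnitaryGroup.inv_val, h1, Matrix.star_eq_conjTranspose,
      conjTranspose_rotation_pauli]
  rw [mem_cliffordGroup_iff]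
  intro U
  constructor
  · exact key 1 (Or.inl rfl) _ _ _ (by simp [h1]) (by simp [h2])
  · intro hU
    have := key (-1) (Or.inr rfl) (rotationUnitary h)⁻¹ (rotationUnitary h) _ (by simp [h2])
      (by simp [h1]) hU
    simpa [mul_assoc] using this

theorem exists_cliffordPerm_eq_transvect (h : PauliLabel m) :
    ∃ g : cliffordGroup m, ∀ a, cliffordPerm m g a = transvect h a := by
  refine ⟨⟨rotationUnitary h, rotationUnitary_mem h⟩, fun a => ?_⟩
  obtain ⟨c, -, l, hl⟩ := rotation_conj_pauli h a (one_mul (1 : ℂ))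
  refine conjLabel_eq (s := c * Complex.I ^ l) ?_
  rw [one_smul] at hl
  rw [← hl]
  change pauliRotation (pauli h) * pauli a * (pauliRotation (pauli h))ᴴ = _
  rw [conjTranspose_rotation_pauli]

end Clifford

section Symplectic

variable {m : ℕ}

theorem symp_smul_right (s : ZMod 2) (a b : PauliLabel m) : symp a (s • b) = s * symp a b := by
  simp [symp, Matrix.mulVec_smul, dotProduct_smul]

theorem symp_smul_left (s : ZMod 2) (a b : PauliLabel m) : symp (s • a) b = s * symp a b := by
  rw [symp_comm, symp_smul_right, symp_comm]

/-- The linear functional `⟨a, ·⟩`. -/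
def sympForm (a : PauliLabel m) : PauliLabel m →ₗ[ZMod 2] ZMod 2 where
  toFun := symp a
  map_add' := symp_add_right a
  map_smul' s b := symp_smul_right s a b

@[simp] theorem sympForm_apply (a b : PauliLabel m) : sympForm a b = symp a b := rfl

theorem symp_nondegenerate {a : PauliLabel m} (h : ∀ b, symp a b = 0) : a = 0 := by
  ext j
  rcases j with j | j
  · have := h (Pi.single (Sum.inr j) 1)
    simpa [symp_eq_sum, Pi.single_apply] using this
  · have := h (Pi.single (Sum.inl j) 1)
    simpa [symp_eq_sum, Pi.single_apply] using this

theorem exists_symp_eq {u v w : PauliLabel m} (h0 : u ≠ 0) (hv : u ≠ v) (hw : u ≠ w)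
    (hvw : u ≠ v + w) : ∃ c, symp u c = 1 ∧ symp v c = 0 ∧ symp w c = 0 := by
  by_contra hc
  push Not at hc
  have hmem : sympForm u ∈ Submodule.span (ZMod 2)
      (Set.range ![sympForm v, sympForm w]) := by
    refine mem_span_of_iInf_ker_le_ker fun c hmem => ?_
    simp only [Submodule.mem_iInf, LinearMap.mem_ker, Fin.forall_fin_two] at hmem
    rcases zmod_two_cases (symp u c) with h | h
    · exact h
    · exact absurd hmem.2 (hc c h hmem.1)
  rw [Matrix.range_cons, Matrix.range_cons, Matrix.range_empty, Set.union_empty,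
    Set.singleton_union, Submodule.mem_span_pair] at hmem
  obtain ⟨p, q, hpq⟩ := hmem
  have hu : u + (p • v + q • w) = 0 := by
    refine symp_nondegenerate fun b => ?_
    have := LinearMap.congr_fun hpq b
    simp only [LinearMap.add_apply, LinearMap.smul_apply, sympForm_apply, smul_eq_mul] at this
    rw [symp_add_left, symp_add_left, symp_smul_left, symp_smul_left, this]
    exact CharTwo.add_self_eq_zero _
  rw [add_label_eq_zero_iff] at hu
  rcases zmod_two_cases p with rfl | rfl <;> rcases zmod_two_cases q with rfl | rfl <;>
    simp_all

theorem exists_cliffordPerm_of_symp_eq_one {b c : PauliLabel m} (h : symp b c = 1) :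
    ∃ g : cliffordGroup m, cliffordPerm m g b = c ∧
      ∀ a, symp a b = symp a c → cliffordPerm m g a = a := by
  obtain ⟨g, hg⟩ := exists_cliffordPerm_eq_transvect (b + c)
  refine ⟨g, ?_, fun a ha => ?_⟩
  · rw [hg, transvect, symp_add_right, symp_self, h, zero_add, one_smul, ← add_assoc,
      add_label_self, zero_add]
  · rw [hg, transvect, symp_add_right, ha, CharTwo.add_self_eq_zero, zero_smul, add_zero]

theorem exists_cliffordPerm_eq {a b : PauliLabel m} (ha : a ≠ 0) (hb : b ≠ 0) :
    ∃ g : cliffordGroup m, cliffordPerm m g a = b := by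
  obtain ⟨c, hc, hc', -⟩ := exists_symp_eq (u := b) (v := a + b) (w := 0) hb
    (by simpa using ha) hb (by simpa using ha)
  rw [symp_add_left, hc] at hc'
  have hac : symp a c = 1 := by
    rcases zmod_two_cases (symp a c) with h | h
    · rw [h] at hc'
      exact absurd hc' (by decide)
    · exact h
  obtain ⟨g, hg, -⟩ := exists_cliffordPerm_of_symp_eq_one hac
  obtain ⟨g', hg', -⟩ := exists_cliffordPerm_of_symp_eq_one ((symp_comm c b).trans hc)
  exact ⟨g' * g, by rw [map_mul, Equiv.Perm.mul_apply, hg, hg']⟩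

theorem exists_cliffordPerm_fix {a b b' : PauliLabel m} (ha : a ≠ 0) (hb : b ≠ 0) (hb' : b' ≠ 0)
    (hab : a ≠ b) (hab' : a ≠ b') (h : symp a b = symp a b') :
    ∃ g : cliffordGroup m, cliffordPerm m g a = a ∧ cliffordPerm m g b = b' := by
  by_cases hbb : b = b'
  · exact ⟨1, by simp [hbb]⟩
  rcases zmod_two_cases (symp b b') with h0 | h1
  · have hdep : symp a b = 1 → a ≠ b + b' := by
      rintro h2 rfl
      rw [symp_add_left, symp_self, symp_comm b' b, h0] at h2
      exact absurd h2 (by decide)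
    obtain ⟨c, hc, hc', hca⟩ := exists_symp_eq (u := b) (v := b + b') (w := a + symp a b • b) hb
      (by simpa using hb')
      (by
        rcases zmod_two_cases (symp a b) with h2 | h2
        · simpa [h2] using hab.symm
        · simpa [h2] using ha)
      (by
        intro heq
        have h3 := add_label_eq_zero_iff.mpr heq
        rw [show b + (b + b' + (a + symp a b • b)) = (b + b) + (b' + a + symp a b • b) by abel,
          add_label_self, zero_add] at h3
        rcases zmod_two_cases (symp a b) with h2 | h2
        · rw [h2, zero_smul, add_zero, add_label_eq_zero_iff] at h3
          exact hab' h3.symm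
        · rw [h2, one_smul, show b' + a + b = a + (b + b') by abel, add_label_eq_zero_iff] at h3
          exact hdep h2 h3)
    rw [symp_add_left, hc] at hc'
    rw [symp_add_left, symp_smul_left, hc, mul_one] at hca
    have hac : symp a c = symp a b := by
      rwa [← sub_eq_zero, CharTwo.sub_eq_add]
    have hbc : symp b' c = 1 := by
      rcases zmod_two_cases (symp b' c) with h2 | h2
      · rw [h2] at hc'
        exact absurd hc' (by decide)
      · exact h2
    obtain ⟨g, hg, hga⟩ := exists_cliffordPerm_of_symp_eq_one hc
    obtain ⟨g', hg', hga'⟩ := exists_cliffordPerm_of_symp_eq_one ((symp_comm c b').trans hbc)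
    refine ⟨g' * g, ?_, ?_⟩
    · rw [map_mul, Equiv.Perm.mul_apply, hga a hac.symm, hga' a (hac.trans h)]
    · rw [map_mul, Equiv.Perm.mul_apply, hg, hg']
  · obtain ⟨g, hg, hga⟩ := exists_cliffordPerm_of_symp_eq_one h1
    exact ⟨g, hga a h, hg⟩

/-- The Clifford group is transitive on the ordered pairs of distinct nonzero labels with a
prescribed symplectic product. -/
theorem exists_cliffordPerm_pair {a b a' b' : PauliLabel m} (ha : a ≠ 0) (hb : b ≠ 0)
    (ha' : a' ≠ 0) (hb' : b' ≠ 0) (hab : a ≠ b) (hab' : a' ≠ b') (h : symp a b = symp a' b') :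
    ∃ g : cliffordGroup m, cliffordPerm m g a = a' ∧ cliffordPerm m g b = b' := by
  obtain ⟨g, rfl⟩ := exists_cliffordPerm_eq ha ha'
  obtain ⟨g', h1, h2⟩ := exists_cliffordPerm_fix ha' (cliffordPerm_ne_zero g hb) hb'
    ((cliffordPerm m g).injective.ne hab) hab' (by rw [symp_cliffordPerm, h])
  exact ⟨g' * g, by simp [h1], by simp [h2]⟩

end Symplectic

section UnitaryRep

open scoped InnerProductSpace

variable {G H : Type} [Group G] [NormedAddCommGroup H] [InnerProductSpace ℂ H]
  [FiniteDimensional ℂ H] {π : Representation ℂ G H}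

theorem starProjection_intertwines (hπ : ∀ g x y, ⟪π g x, π g y⟫_ℂ = ⟪x, y⟫_ℂ)
    {U : Submodule ℂ H} (hU : ∀ g, ∀ x ∈ U, π g x ∈ U) (g : G) (x : H) :
    U.starProjection (π g x) = π g (U.starProjection x) := by
  refine Submodule.eq_starProjection_of_mem_orthogonal (hU g _ (U.starProjection_apply_mem x)) ?_
  rw [← map_sub, Submodule.mem_orthogonal]
  intro u hu
  rw [← hπ g⁻¹, Representation.inv_self_apply]
  exact Submodule.inner_right_of_mem_orthogonal (hU _ _ hu)
    (Submodule.sub_starProjection_mem_orthogonal x)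

theorem eq_bot_or_eq_of_scalar (hπ : ∀ g x y, ⟪π g x, π g y⟫_ℂ = ⟪x, y⟫_ℂ)
    {E U : Submodule ℂ H}
    (hE : ∀ T : H →ₗ[ℂ] H, (∀ g x, T (π g x) = π g (T x)) → ∃ c : ℂ, ∀ x ∈ E, T x = c • x)
    (hU : ∀ g, ∀ x ∈ U, π g x ∈ U) (hUE : U ≤ E) : U = ⊥ ∨ U = E := by
  obtain ⟨c, hc⟩ := hE U.starProjection.toLinearMap (starProjection_intertwines hπ hU)
  by_cases h0 : c = 0
  · left
    rw [Submodule.eq_bot_iff]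
    intro x hx
    have h1 := hc x (hUE hx)
    rw [h0, zero_smul] at h1
    rw [← h1]
    exact (Submodule.starProjection_eq_self_iff.mpr hx).symm
  · right
    refine le_antisymm hUE fun x hx => ?_
    have h1 : U.starProjection x = c • x := hc x hx
    have h2 : c • x ∈ U := h1 ▸ U.starProjection_apply_mem x
    exact (Submodule.smul_mem_iff U h0).mp h2

theorem eq_bot_of_injective_intertwiner (hπ : ∀ g x y, ⟪π g x, π g y⟫_ℂ = ⟪x, y⟫_ℂ)
    {E F : Submodule ℂ H}
    (hE : ∀ T : H →ₗ[ℂ] H, (∀ g x, T (π g x) = π g (T x)) → ∃ c : ℂ, ∀ x ∈ E, T x = c • x)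
    (hinv : ∀ g, ∀ x ∈ E, π g x ∈ E) (hEF : Disjoint E F) (φ : E →ₗ[ℂ] F)
    (hφ : Function.Injective φ)
    (hφπ : ∀ g (x : E), (φ ⟨π g x, hinv g x x.2⟩ : H) = π g (φ x)) : E = ⊥ := by
  let T : H →ₗ[ℂ] H := F.subtype ∘ₗ φ ∘ₗ E.orthogonalProjectionOnto.toLinearMap
  have hT : ∀ g x, T (π g x) = π g (T x) := by
    intro g x
    have h1 : E.orthogonalProjectionOnto (π g x) =
        ⟨π g (E.orthogonalProjectionOnto x), hinv g _ (E.orthogonalProjectionOnto x).2⟩ :=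
      Subtype.ext (starProjection_intertwines hπ hinv g x)
    change (φ (E.orthogonalProjectionOnto (π g x)) : H) = π g (φ (E.orthogonalProjectionOnto x))
    rw [h1, hφπ]
  obtain ⟨c, hc⟩ := hE T hT
  rw [Submodule.eq_bot_iff]
  intro x hx
  have h1 : T x = φ ⟨x, hx⟩ := by
    change (φ (E.orthogonalProjectionOnto x) : H) = φ ⟨x, hx⟩
    rw [show E.orthogonalProjectionOnto x = ⟨x, hx⟩ from
      Submodule.orthogonalProjectionOnto_mem_subspace_eq_self (⟨x, hx⟩ : E)]
  have h2 : (φ ⟨x, hx⟩ : H) = 0 :=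
    Submodule.disjoint_def.mp hEF _ (h1 ▸ hc x hx ▸ E.smul_mem c hx) (φ ⟨x, hx⟩).2
  have h3 : φ ⟨x, hx⟩ = 0 := Subtype.ext h2
  rw [map_eq_zero_iff φ hφ] at h3
  exact congrArg Subtype.val h3

variable {M : Type} [AddCommGroup M] [Module ℂ M] {ρ : Representation ℂ G M}

/-- The image of an invariant subspace under an intertwining map. -/
def mapSubrep (Φ : H →ₗ[ℂ] M) (hΦ : ∀ g x, Φ (π g x) = ρ g (Φ x)) (E : Submodule ℂ H)
    (hinv : ∀ g, ∀ x ∈ E, π g x ∈ E) : Subrepresentation ρ where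
  toSubmodule := E.map Φ
  apply_mem_toSubmodule := by
    rintro g _ ⟨x, hx, rfl⟩
    exact ⟨π g x, hinv g x hx, hΦ g x⟩

theorem mapSubrep_isIrreducible (hπ : ∀ g x y, ⟪π g x, π g y⟫_ℂ = ⟪x, y⟫_ℂ)
    {Φ : H →ₗ[ℂ] M} (hinj : Function.Injective Φ) (hΦ : ∀ g x, Φ (π g x) = ρ g (Φ x))
    {E : Submodule ℂ H}
    (hE : ∀ T : H →ₗ[ℂ] H, (∀ g x, T (π g x) = π g (T x)) → ∃ c : ℂ, ∀ x ∈ E, T x = c • x)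
    (hinv : ∀ g, ∀ x ∈ E, π g x ∈ E) (hne : E ≠ ⊥) :
    (mapSubrep Φ hΦ E hinv).toRepresentation.IsIrreducible := by
  obtain ⟨x₀, hx₀, hx₀'⟩ := (Submodule.ne_bot_iff E).mp hne
  let y₀ : (mapSubrep Φ hΦ E hinv).toSubmodule := ⟨Φ x₀, x₀, hx₀, rfl⟩
  have hy₀ : y₀ ≠ 0 := fun h =>
    hx₀' ((map_eq_zero_iff Φ hinj).mp (congrArg Subtype.val h))
  have hnt : Nontrivial (Subrepresentation (mapSubrep Φ hΦ E hinv).toRepresentation) := by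
    refine ⟨⊥, ⊤, fun h => hy₀ ?_⟩
    have h1 : y₀ ∈ (⊤ : Subrepresentation (mapSubrep Φ hΦ E hinv).toRepresentation) :=
      Submodule.mem_top
    rw [← h] at h1
    exact (Submodule.mem_bot ℂ).mp h1
  refine { hnt with eq_bot_or_eq_top := fun S => ?_ }
  let U : Submodule ℂ H := (S.toSubmodule.map (Submodule.subtype _)).comap Φ
  have hU : ∀ g, ∀ x ∈ U, π g x ∈ U := by
    rintro g x ⟨y, hy, hyx⟩
    refine ⟨_, S.apply_mem_toSubmodule g hy, ?_⟩
    rw [hΦ, ← hyx]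
    rfl
  have hUE : U ≤ E := by
    rintro x ⟨y, -, hyx⟩
    obtain ⟨z, hz, hzy⟩ := y.2
    have : z = x := hinj (hzy.trans hyx)
    exact this ▸ hz
  rcases eq_bot_or_eq_of_scalar hπ hE hU hUE with h | h
  · left
    apply Subrepresentation.toSubmodule_injective
    refine (Submodule.eq_bot_iff _).mpr fun y hy => ?_
    obtain ⟨z, hz, hzy⟩ := y.2
    have hzU : z ∈ U := ⟨y, hy, hzy.symm⟩
    rw [h, Submodule.mem_bot] at hzU
    apply Subtype.ext
    rw [← hzy, hzU, map_zero]
    rfl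
  · right
    apply Subrepresentation.toSubmodule_injective
    refine eq_top_iff.mpr fun y _ => ?_
    obtain ⟨z, hz, hzy⟩ := y.2
    have hzU : z ∈ U := h ▸ hz
    obtain ⟨y', hy', hy'z⟩ := hzU
    have : y' = y := Subtype.ext (hy'z.trans hzy)
    exact this ▸ hy'

theorem mapSubrep_isEmpty_equiv (hπ : ∀ g x y, ⟪π g x, π g y⟫_ℂ = ⟪x, y⟫_ℂ)
    {Φ : H →ₗ[ℂ] M} (hinj : Function.Injective Φ) (hΦ : ∀ g x, Φ (π g x) = ρ g (Φ x))
    {E F : Submodule ℂ H}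
    (hE : ∀ T : H →ₗ[ℂ] H, (∀ g x, T (π g x) = π g (T x)) → ∃ c : ℂ, ∀ x ∈ E, T x = c • x)
    (hEinv : ∀ g, ∀ x ∈ E, π g x ∈ E) (hFinv : ∀ g, ∀ x ∈ F, π g x ∈ F)
    (hEF : Disjoint E F) (hne : E ≠ ⊥) :
    IsEmpty ((mapSubrep Φ hΦ E hEinv).toRepresentation.Equiv
      (mapSubrep Φ hΦ F hFinv).toRepresentation) := by
  refine ⟨fun L => hne ?_⟩
  let eE := Submodule.equivMapOfInjective Φ hinj E
  let eF := Submodule.equivMapOfInjective Φ hinj F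
  let φ : E →ₗ[ℂ] F := eF.symm.toLinearMap ∘ₗ L.toLinearEquiv.toLinearMap ∘ₗ eE.toLinearMap
  refine eq_bot_of_injective_intertwiner hπ hE hEinv hEF φ
    (eF.symm.injective.comp (L.toLinearEquiv.injective.comp eE.injective)) fun g x => ?_
  have key : ∀ z : E, Φ (φ z) = (L.toLinearEquiv (eE z) : M) := fun z =>
    congrArg Subtype.val (eF.apply_symm_apply (L.toLinearEquiv (eE z)))
  apply hinj
  rw [key, hΦ, key]
  have h1 : eE ⟨π g x, hEinv g x x.2⟩ =
      (mapSubrep Φ hΦ E hEinv).toRepresentation g (eE x) := Subtype.ext (hΦ g x)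
  rw [h1]
  exact congrArg Subtype.val (Representation.IntertwiningMap.isIntertwining _ _ L.toIntertwiningMap g (eE x))

end UnitaryRep

section PermRep

open scoped InnerProductSpace

variable {G X : Type} [Group G] [Fintype X]

/-- The permutation representation on functions on a finite set. -/
noncomputable def permRep (σ : G →* Equiv.Perm X) :
    Representation ℂ G (EuclideanSpace ℂ X) where
  toFun g := (LinearIsometryEquiv.piLpCongrLeft 2 ℂ ℂ (σ g)).toLinearEquiv.toLinearMap
  map_one' := by
    rw [map_one]
    rfl
  map_mul' g h := by
    rw [map_mul]
    rfl

theorem permRep_apply (σ : G →* Equiv.Perm X) (g : G) (f : EuclideanSpace ℂ X) (x : X) :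
    permRep σ g f x = f ((σ g).symm x) := rfl

theorem permRep_inner (σ : G →* Equiv.Perm X) (g : G) (f f' : EuclideanSpace ℂ X) :
    ⟪permRep σ g f, permRep σ g f'⟫_ℂ = ⟪f, f'⟫_ℂ :=
  (LinearIsometryEquiv.piLpCongrLeft 2 ℂ ℂ (σ g)).inner_map_map f f'

/-- The operator on functions with kernel `K`. -/
noncomputable def kernelOp (K : X → X → ℂ) : EuclideanSpace ℂ X →ₗ[ℂ] EuclideanSpace ℂ X where
  toFun f := WithLp.toLp 2 fun x => ∑ y, K x y * f y
  map_add' f f' := by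
    ext x
    simp [mul_add, Finset.sum_add_distrib]
  map_smul' c f := by
    ext x
    simp only [PiLp.smul_apply, smul_eq_mul, RingHom.id_apply, Finset.mul_sum]
    exact Finset.sum_congr rfl fun y _ => by ring

theorem kernelOp_apply (K : X → X → ℂ) (f : EuclideanSpace ℂ X) (x : X) :
    kernelOp K f x = ∑ y, K x y * f y := rfl

theorem kernelOp_permRep {σ : G →* Equiv.Perm X} {K : X → X → ℂ}
    (hK : ∀ g x y, K (σ g x) (σ g y) = K x y) (g : G) (f : EuclideanSpace ℂ X) :
    kernelOp K (permRep σ g f) = permRep σ g (kernelOp K f) := by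
  ext x
  rw [permRep_apply, kernelOp_apply, kernelOp_apply]
  refine (Fintype.sum_equiv (σ g) _ _ fun y => ?_).symm
  rw [permRep_apply, Equiv.symm_apply_apply, ← hK g, Equiv.apply_symm_apply]

theorem apply_eq_sum_kernel [DecidableEq X] (T : EuclideanSpace ℂ X →ₗ[ℂ] EuclideanSpace ℂ X)
    (f : EuclideanSpace ℂ X) (x : X) :
    T f x = ∑ y, T (EuclideanSpace.single y 1) x * f y := by
  have hf : f = ∑ y, f y • EuclideanSpace.single y (1 : ℂ) := by
    ext z
    simp [Pi.single_apply]
  conv_lhs => rw [hf]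
  rw [map_sum]
  simp [mul_comm]

theorem kernel_invariant [DecidableEq X] {σ : G →* Equiv.Perm X}
    {T : EuclideanSpace ℂ X →ₗ[ℂ] EuclideanSpace ℂ X}
    (hT : ∀ g f, T (permRep σ g f) = permRep σ g (T f)) (g : G) (x y : X) :
    T (EuclideanSpace.single (σ g y) 1) (σ g x) = T (EuclideanSpace.single y 1) x := by
  have h1 : permRep σ g (EuclideanSpace.single y (1 : ℂ)) = EuclideanSpace.single (σ g y) 1 :=
    LinearIsometryEquiv.piLpCongrLeft_single (p := 2) (𝕜 := ℂ) (σ g) y 1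
  rw [← h1, hT, permRep_apply, Equiv.symm_apply_apply]

variable {M : Type} [AddCommGroup M] [Module ℂ M]

/-- The linear map sending the indicator function of `x` to `e x`. -/
noncomputable def combination (e : X → M) : EuclideanSpace ℂ X →ₗ[ℂ] M :=
  Fintype.linearCombination ℂ e ∘ₗ (WithLp.linearEquiv 2 ℂ (X → ℂ)).toLinearMap

theorem combination_apply (e : X → M) (f : EuclideanSpace ℂ X) :
    combination e f = ∑ x, f x • e x := rfl

theorem combination_single [DecidableEq X] (e : X → M) (x : X) :
    combination e (EuclideanSpace.single x 1) = e x := by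
  simp [combination_apply, PiLp.single_apply]

theorem combination_injective {e : X → M} (he : LinearIndependent ℂ e) :
    Function.Injective (combination e) :=
  (linearIndependent_iff_injective_fintypeLinearCombination.mp he).comp
    (WithLp.linearEquiv 2 ℂ (X → ℂ)).injective

theorem range_combination (e : X → M) :
    LinearMap.range (combination e) = Submodule.span ℂ (Set.range e) := by
  rw [combination, LinearMap.range_comp, LinearEquiv.range, Submodule.map_top,
    Fintype.range_linearCombination]

theorem combination_permRep {σ : G →* Equiv.Perm X} {ρ : Representation ℂ G M} {e : X → M}
    (he : ∀ g x, ρ g (e x) = e (σ g x)) (g : G) (f : EuclideanSpace ℂ X) :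
    combination e (permRep σ g f) = ρ g (combination e f) := by
  rw [combination_apply, combination_apply, map_sum]
  refine (Fintype.sum_equiv (σ g) _ _ fun x => ?_).symm
  rw [permRep_apply, Equiv.symm_apply_apply, map_smul, he]

end PermRep

section RankThree

variable {m : ℕ}

/-- The nonzero Pauli labels. -/
abbrev NonzeroLabel (m : ℕ) : Type := {a : PauliLabel m // a ≠ 0}

/-- The permutation of the nonzero Pauli labels induced by a Clifford unitary. -/
noncomputable def labelPerm (m : ℕ) : cliffordGroup m →* Equiv.Perm (NonzeroLabel m) where
  toFun g := (cliffordPerm m g).subtypePerm fun a => by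
    rw [← cliffordPerm_zero g, (cliffordPerm m g).injective.ne_iff]
    simp
  map_one' := by
    ext x
    simp
  map_mul' g h := by
    ext1 x
    apply Subtype.ext
    simp only [map_mul, Equiv.Perm.mul_apply, Equiv.Perm.subtypePerm_apply]

@[simp] theorem labelPerm_coe (g : cliffordGroup m) (x : NonzeroLabel m) :
    (labelPerm m g x : PauliLabel m) = cliffordPerm m g x := rfl

theorem sum_nonzeroLabel (f : PauliLabel m → ℂ) :
    ∑ x : NonzeroLabel m, f x = (∑ a, f a) - f 0 := by
  rw [eq_sub_iff_add_eq, ← Finset.sum_erase_add _ _ (Finset.mem_univ (0 : PauliLabel m))]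
  congr 1
  exact (Finset.sum_subtype _ (fun a => by simp) f).symm

theorem sum_signChar_symp_of_ne_zero {u : PauliLabel m} (hu : u ≠ 0) :
    ∑ a, signChar (symp u a) = 0 := by
  obtain ⟨c, hc, -⟩ := exists_symp_eq hu hu hu (by simpa using hu)
  have h : ∑ a, signChar (symp u a) = -∑ a, signChar (symp u a) := by
    conv_lhs => rw [← Equiv.sum_comp (Equiv.addRight c)]
    simp [AddChar.map_add_eq_mul, hc]
  linear_combination h / 2

theorem sum_signChar_symp (u : PauliLabel m) :
    ∑ x : NonzeroLabel m, signChar (symp u x) = (if u = 0 then (2 ^ m) ^ 2 else 0) - 1 := by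
  rw [sum_nonzeroLabel fun a => signChar (symp u a)]
  split_ifs with h
  · subst h
    simp [← pow_mul, mul_two]
  · simp [sum_signChar_symp_of_ne_zero h]

/-- The operator on functions on the nonzero labels with kernel `(-1) ^ ⟨x, y⟩`. -/
noncomputable def signOp (m : ℕ) :
    EuclideanSpace ℂ (NonzeroLabel m) →ₗ[ℂ] EuclideanSpace ℂ (NonzeroLabel m) :=
  kernelOp fun x y => signChar (symp x.1 y.1)

/-- The constant function `1` on the nonzero labels. -/
noncomputable def oneFun (m : ℕ) : EuclideanSpace ℂ (NonzeroLabel m) :=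
  WithLp.toLp 2 fun _ => 1

theorem signOp_oneFun : signOp m (oneFun m) = -oneFun m := by
  ext x
  simp only [signOp, kernelOp_apply, oneFun, mul_one, PiLp.neg_apply]
  rw [sum_signChar_symp, if_neg x.2]
  ring

theorem signOp_signOp (f : EuclideanSpace ℂ (NonzeroLabel m)) :
    signOp m (signOp m f) = ((2 : ℂ) ^ m) ^ 2 • f - (∑ x, f x) • oneFun m := by
  ext x
  simp only [signOp, kernelOp_apply, oneFun, PiLp.sub_apply, PiLp.smul_apply, smul_eq_mul,
    mul_one, Finset.mul_sum]
  rw [Finset.sum_comm]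
  have key : ∀ y : NonzeroLabel m,
      ∑ z : NonzeroLabel m, signChar (symp x.1 z.1) * (signChar (symp z.1 y.1) * f y) =
      (if x = y then ((2 : ℂ) ^ m) ^ 2 * f y else 0) - f y := by
    intro y
    have h1 := sum_signChar_symp (x.1 + y.1)
    simp only [add_label_eq_zero_iff, Subtype.coe_inj] at h1
    calc _ = (∑ z : NonzeroLabel m, signChar (symp (x.1 + y.1) z.1)) * f y := by
          rw [Finset.sum_mul]
          refine Finset.sum_congr rfl fun z _ => ?_
          rw [symp_add_left, AddChar.map_add_eq_mul, symp_comm y.1, mul_assoc]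
      _ = _ := by
          rw [h1]
          split_ifs <;> ring
  simp only [key, Finset.sum_sub_distrib, Finset.sum_ite_eq, Finset.mem_univ, if_true]

theorem exists_common_value {t : NonzeroLabel m → NonzeroLabel m → ℂ}
    (ht : ∀ g x y, t (labelPerm m g x) (labelPerm m g y) = t x y) (s : ZMod 2) :
    ∃ p, ∀ x y : NonzeroLabel m, x ≠ y → symp x.1 y.1 = s → t x y = p := by
  by_cases h : ∃ x y : NonzeroLabel m, x ≠ y ∧ symp x.1 y.1 = s
  · obtain ⟨x₀, y₀, h0, hs⟩ := h
    refine ⟨t x₀ y₀, fun x y hxy hs' => ?_⟩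
    obtain ⟨g, h1, h2⟩ := exists_cliffordPerm_pair x₀.2 y₀.2 x.2 y.2
      (Subtype.coe_injective.ne h0) (Subtype.coe_injective.ne hxy) (hs.trans hs'.symm)
    rw [← ht g x₀ y₀]
    congr 1
    · exact Subtype.ext h1.symm
    · exact Subtype.ext h2.symm
  · push Not at h
    exact ⟨0, fun x y hxy hs => absurd hs (h x y hxy)⟩

theorem exists_common_diagonal_value {t : NonzeroLabel m → NonzeroLabel m → ℂ}
    (ht : ∀ g x y, t (labelPerm m g x) (labelPerm m g y) = t x y) :
    ∃ d, ∀ x : NonzeroLabel m, t x x = d := by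
  rcases isEmpty_or_nonempty (NonzeroLabel m) with h | ⟨⟨x₀⟩⟩
  · exact ⟨0, fun x => (h.false x).elim⟩
  · refine ⟨t x₀ x₀, fun x => ?_⟩
    obtain ⟨g, hg⟩ := exists_cliffordPerm_eq x₀.2 x.2
    rw [← ht g x₀ x₀, show labelPerm m g x₀ = x from Subtype.ext hg]

/-- Operators commuting with the Clifford action are combinations of the identity, the sign
operator and the all-ones operator. -/
theorem intertwiner_eq
    {T : EuclideanSpace ℂ (NonzeroLabel m) →ₗ[ℂ] EuclideanSpace ℂ (NonzeroLabel m)}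
    (hT : ∀ g f, T (permRep (labelPerm m) g f) = permRep (labelPerm m) g (T f)) :
    ∃ α β γ : ℂ, ∀ f, T f = α • f + β • signOp m f + γ • (∑ x, f x) • oneFun m := by
  have ht := kernel_invariant hT
  obtain ⟨p, hp⟩ := exists_common_value
    (t := fun x y => T (EuclideanSpace.single y 1) x) (fun g x y => ht g x y) 0
  obtain ⟨q, hq⟩ := exists_common_value
    (t := fun x y => T (EuclideanSpace.single y 1) x) (fun g x y => ht g x y) 1
  obtain ⟨d, hd⟩ := exists_common_diagonal_value
    (t := fun x y => T (EuclideanSpace.single y 1) x) (fun g x y => ht g x y)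
  refine ⟨d - p, (p - q) / 2, (p + q) / 2, fun f => ?_⟩
  ext x
  have key : ∀ y : NonzeroLabel m, T (EuclideanSpace.single y 1) x =
      (if x = y then d - p else 0) + (p - q) / 2 * signChar (symp x.1 y.1) + (p + q) / 2 := by
    intro y
    by_cases hxy : x = y
    · subst hxy
      rw [hd x, if_pos rfl, symp_self, AddChar.map_zero_eq_one]
      ring
    · rw [if_neg hxy]
      rcases zmod_two_cases (symp x.1 y.1) with h | h
      · rw [hp x y hxy h, h, AddChar.map_zero_eq_one]
        ring
      · rw [hq x y hxy h, h, signChar_one]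
        ring
  rw [apply_eq_sum_kernel]
  simp only [key, add_mul, Finset.sum_add_distrib, ite_mul, zero_mul, Finset.sum_ite_eq,
    Finset.mem_univ, if_true, PiLp.add_apply, PiLp.smul_apply, smul_eq_mul, signOp,
    kernelOp_apply, oneFun, mul_one, Finset.mul_sum, mul_assoc]

theorem signOp_permRep (g : cliffordGroup m) (f : EuclideanSpace ℂ (NonzeroLabel m)) :
    signOp m (permRep (labelPerm m) g f) = permRep (labelPerm m) g (signOp m f) :=
  kernelOp_permRep (fun g x y => by simp only [labelPerm_coe, symp_cliffordPerm]) g f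

theorem intertwiner_scalar_on_eigenspace (μ : ℂ)
    (T : EuclideanSpace ℂ (NonzeroLabel m) →ₗ[ℂ] EuclideanSpace ℂ (NonzeroLabel m))
    (hT : ∀ g f, T (permRep (labelPerm m) g f) = permRep (labelPerm m) g (T f)) :
    ∃ c : ℂ, ∀ f ∈ Module.End.eigenspace (signOp m) μ, T f = c • f := by
  obtain ⟨α, β, γ, h⟩ := intertwiner_eq hT
  refine ⟨α + β * μ + γ * (((2 : ℂ) ^ m) ^ 2 - μ ^ 2), fun f hf => ?_⟩
  rw [Module.End.mem_eigenspace_iff] at hf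
  have h1 := signOp_signOp f
  rw [hf, map_smul, hf, eq_sub_iff_add_eq, ← eq_sub_iff_add_eq'] at h1
  rw [h, h1, hf]
  module

theorem eigenspace_permRep_mem (μ : ℂ) (g : cliffordGroup m)
    (f : EuclideanSpace ℂ (NonzeroLabel m)) (hf : f ∈ Module.End.eigenspace (signOp m) μ) :
    permRep (labelPerm m) g f ∈ Module.End.eigenspace (signOp m) μ := by
  rw [Module.End.mem_eigenspace_iff] at hf ⊢
  rw [signOp_permRep, hf, map_smul]

/-- The eigenvalues `-1`, `N`, `-N` of the sign operator. -/
noncomputable def signEigenvalue (m : ℕ) : Fin 3 → ℂ := ![-1, 2 ^ m, -2 ^ m]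

theorem four_le_two_pow (hm : 2 ≤ m) : (4 : ℝ) ≤ 2 ^ m := by
  calc (4 : ℝ) = 2 ^ 2 := by norm_num
    _ ≤ 2 ^ m := pow_le_pow_right₀ (by norm_num) hm

theorem two_pow_ne_ofReal (hm : 2 ≤ m) {r : ℝ} (hr : r < 4) : (2 : ℂ) ^ m ≠ r := by
  have h := four_le_two_pow hm
  intro h'
  have h2 : (2 : ℝ) ^ m = r := by exact_mod_cast h'
  linarith

theorem signEigenvalue_injective (hm : 2 ≤ m) : Function.Injective (signEigenvalue m) := by
  have h1 : (2 : ℂ) ^ m ≠ -1 := by simpa using two_pow_ne_ofReal hm (r := -1) (by norm_num)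
  have h2 : (2 : ℂ) ^ m ≠ 1 := by simpa using two_pow_ne_ofReal hm (r := 1) (by norm_num)
  have h3 : (2 : ℂ) ^ m ≠ -2 ^ m := by
    intro h
    exact pow_ne_zero m (two_ne_zero (α := ℂ)) (by linear_combination h / 2)
  intro i j hij
  fin_cases i <;> fin_cases j <;> simp [signEigenvalue] at hij ⊢
  · exact h1 hij.symm
  · exact h2 hij.symm
  · exact h1 hij
  · exact h3 hij
  · exact h2 hij
  · exact h3 hij.symm

theorem iSup_eigenspace (hm : 2 ≤ m) :
    ⨆ i, Module.End.eigenspace (signOp m) (signEigenvalue m i) = ⊤ := by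
  have hN : (2 : ℂ) ^ m ≠ 0 := pow_ne_zero _ two_ne_zero
  have hN1 : ((2 : ℂ) ^ m) ^ 2 - 1 ≠ 0 := by
    have h1 : (2 : ℂ) ^ m ≠ -1 := by simpa using two_pow_ne_ofReal hm (r := -1) (by norm_num)
    have h2 : (2 : ℂ) ^ m ≠ 1 := by simpa using two_pow_ne_ofReal hm (r := 1) (by norm_num)
    rw [show ((2 : ℂ) ^ m) ^ 2 - 1 = (2 ^ m - 1) * (2 ^ m - -1) by ring]
    exact mul_ne_zero (sub_ne_zero.mpr h2) (sub_ne_zero.mpr h1)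
  rw [eq_top_iff]
  intro f _
  set s : ℂ := ∑ x, f x
  set j := (s / (((2 : ℂ) ^ m) ^ 2 - 1)) • oneFun m with hj
  set g := f - j with hg
  have hBj : signOp m j = -j := by rw [hj, map_smul, signOp_oneFun, smul_neg]
  have hBg : signOp m (signOp m g) = ((2 : ℂ) ^ m) ^ 2 • g := by
    rw [hg, map_sub, map_sub, hBj, map_neg, hBj, neg_neg, signOp_signOp, hj, smul_sub, smul_smul,
      sub_sub, ← add_smul]
    congr 2
    field_simp
    ring
  have hdec : f = j + ((1 / 2 : ℂ) • (g + ((2 : ℂ) ^ m)⁻¹ • signOp m g) +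
      (1 / 2 : ℂ) • (g - ((2 : ℂ) ^ m)⁻¹ • signOp m g)) := by
    rw [hg]
    module
  clear_value g
  have hmem : ∀ i, Module.End.eigenspace (signOp m) (signEigenvalue m i) ≤
      ⨆ i, Module.End.eigenspace (signOp m) (signEigenvalue m i) := fun i =>
    le_iSup (fun i => Module.End.eigenspace (signOp m) (signEigenvalue m i)) i
  rw [hdec]
  refine Submodule.add_mem _ (hmem 0 ?_) (Submodule.add_mem _
    (Submodule.smul_mem _ _ (hmem 1 ?_)) (Submodule.smul_mem _ _ (hmem 2 ?_)))
  · rw [Module.End.mem_eigenspace_iff, hBj]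
    simp [signEigenvalue]
  · rw [Module.End.mem_eigenspace_iff, map_add, map_smul, hBg, smul_smul, smul_add, smul_smul]
    simp only [signEigenvalue, Matrix.cons_val]
    rw [mul_inv_cancel₀ hN, one_smul, show ((2 : ℂ) ^ m)⁻¹ * ((2 : ℂ) ^ m) ^ 2 = 2 ^ m by
      field_simp, add_comm]
  · rw [Module.End.mem_eigenspace_iff, map_sub, map_smul, hBg, smul_smul, smul_sub, smul_smul]
    simp only [signEigenvalue, Matrix.cons_val]
    rw [neg_mul, mul_inv_cancel₀ hN, show ((2 : ℂ) ^ m)⁻¹ * ((2 : ℂ) ^ m) ^ 2 = 2 ^ m by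
      field_simp]
    module

theorem exists_pair_nonzeroLabel (hm : 2 ≤ m) : ∃ x y : NonzeroLabel m, x ≠ y := by
  let i : Fin m := ⟨0, by omega⟩
  refine ⟨⟨Pi.single (Sum.inl i) 1, by simp⟩, ⟨Pi.single (Sum.inr i) 1, by simp⟩, fun h => ?_⟩
  have := congrFun (congrArg Subtype.val h) (Sum.inl i)
  simp at this

theorem eigenspace_ne_bot (hm : 2 ≤ m) (i : Fin 3) :
    Module.End.eigenspace (signOp m) (signEigenvalue m i) ≠ ⊥ := by
  obtain ⟨x, y, hxy⟩ := exists_pair_nonzeroLabel hm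
  have hpm : ∀ e : ℂ, (e = 1 ∨ e = -1) →
      Module.End.eigenspace (signOp m) (e * 2 ^ m) ≠ ⊥ := by
    intro e he
    have hee : e * e = 1 := by rcases he with rfl | rfl <;> norm_num
    set f : EuclideanSpace ℂ (NonzeroLabel m) :=
      EuclideanSpace.single x 1 - EuclideanSpace.single y 1 with hf
    have hsum : ∑ z, f z = 0 := by simp [hf, PiLp.single_apply]
    have hBB : signOp m (signOp m f) = ((2 : ℂ) ^ m) ^ 2 • f := by
      rw [signOp_signOp, hsum, zero_smul, sub_zero]
    refine (Submodule.ne_bot_iff _).mpr ⟨(2 : ℂ) ^ m • f + e • signOp m f, ?_, ?_⟩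
    · rw [Module.End.mem_eigenspace_iff, map_add, map_smul, map_smul, hBB, smul_add, smul_smul,
        smul_smul, smul_smul, add_comm]
      congr 2
      · ring
      · linear_combination -(2 : ℂ) ^ m * hee
    · intro h
      have h1 := congrFun (congrArg WithLp.ofLp h) x
      have h2 : signOp m f x = 1 - signChar (symp x.1 y.1) := by
        simp [signOp, kernelOp_apply, hf]
      have h3 : f x = 1 := by simp [hf, hxy]
      simp only [PiLp.add_apply, PiLp.smul_apply, h2, h3, smul_eq_mul, mul_one] at h1
      change _ = (0 : ℂ) at h1
      have hb : ∀ r : ℝ, r < 4 → (2 : ℂ) ^ m ≠ r := fun r hr => two_pow_ne_ofReal hm hr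
      rcases zmod_two_cases (symp x.1 y.1) with hs | hs
      · rw [hs, AddChar.map_zero_eq_one] at h1
        exact hb 0 (by norm_num) (by push_cast; linear_combination h1)
      · rw [hs, signChar_one] at h1
        rcases he with rfl | rfl
        · exact hb (-2) (by norm_num) (by push_cast; linear_combination h1)
        · exact hb 2 (by norm_num) (by push_cast; linear_combination h1)
  fin_cases i
  · refine (Submodule.ne_bot_iff _).mpr ⟨oneFun m, ?_, fun h => ?_⟩
    · rw [Module.End.mem_eigenspace_iff, signOp_oneFun]
      simp [signEigenvalue]
    · have h1 := congrFun (congrArg WithLp.ofLp h) x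
      exact one_ne_zero h1
  · simpa [signEigenvalue] using hpm 1 (Or.inl rfl)
  · simpa [signEigenvalue] using hpm (-1) (Or.inr rfl)

end RankThree

section Sectors

variable {m : ℕ}

theorem adjointRep_normTensor {t : ℕ} (g : cliffordGroup m)
    (A : Fin t → Matrix (Qubits m) (Qubits m) ℂ) :
    adjointRep m t g (normTensor A) = normTensor fun j =>
      (g.1 : Matrix (Qubits m) (Qubits m) ℂ) * A j *
        (g.1 : Matrix (Qubits m) (Qubits m) ℂ)ᴴ := by
  change tensorMat (fun _ => (g.1 : Matrix (Qubits m) (Qubits m) ℂ)) * normTensor A *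
    tensorMat (fun _ => (g.1 : Matrix (Qubits m) (Qubits m) ℂ)ᴴ) = _
  rw [normTensor, normTensor, Matrix.mul_smul, Matrix.smul_mul, ← tensorMat_mul, ← tensorMat_mul]

theorem normTensor_smul {t : ℕ} (c : Fin t → ℂ) (A : Fin t → Matrix (Qubits m) (Qubits m) ℂ) :
    normTensor (fun j => c j • A j) = (∏ j, c j) • normTensor A := by
  rw [normTensor, normTensor, tensorMat_smul, smul_comm]

theorem adjointRep_ketPair (g : cliffordGroup m) (a : PauliLabel m) :
    adjointRep m 2 g (ketPair a) = ketPair (cliffordPerm m g a) := by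
  obtain ⟨s, hs, h⟩ := conj_pauli g a
  rw [ketPair, adjointRep_normTensor]
  have : (fun j => (g.1 : Matrix (Qubits m) (Qubits m) ℂ) * ![pauli a, pauli a] j *
      (g.1 : Matrix (Qubits m) (Qubits m) ℂ)ᴴ) =
      fun j => ![s, s] j • ![pauli (conjLabel g a), pauli (conjLabel g a)] j := by
    funext j
    fin_cases j <;> simpa using h
  rw [this, normTensor_smul, Fin.prod_univ_two]
  simp [hs, ketPair, cliffordPerm_apply]

theorem adjointRep_ketTriple (g : cliffordGroup m) (a b : PauliLabel m) :
    adjointRep m 3 g (ketTriple a b) = ketTriple (cliffordPerm m g a) (cliffordPerm m g b) := by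
  obtain ⟨s, hs, ha⟩ := conj_pauli g a
  obtain ⟨t, ht, hb⟩ := conj_pauli g b
  have hab := (conj_mul_conj g.1 (pauli a) (pauli b)).symm
  rw [ha, hb, Matrix.smul_mul, Matrix.mul_smul, smul_smul] at hab
  rw [ketTriple, map_smul, adjointRep_normTensor, ketTriple, symp_cliffordPerm]
  have : (fun j => (g.1 : Matrix (Qubits m) (Qubits m) ℂ) *
      ![pauli a, pauli b, pauli a * pauli b] j *
      (g.1 : Matrix (Qubits m) (Qubits m) ℂ)ᴴ) =
      fun j => ![s, t, s * t] j • ![pauli (conjLabel g a), pauli (conjLabel g b),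
        pauli (conjLabel g a) * pauli (conjLabel g b)] j := by
    funext j
    fin_cases j
    · exact ha
    · exact hb
    · exact hab
  have hst : s * t * (s * t) = 1 := by linear_combination t * t * hs + ht
  rw [this, normTensor_smul, Fin.prod_univ_three]
  simp [hst, cliffordPerm_apply]

theorem adjointRep_ketBar (g : cliffordGroup m) (a : PauliLabel m) :
    adjointRep m 3 g (ketBar a) = ketBar (cliffordPerm m g a) := by
  rw [ketBar, ketBar, map_smul, map_sum]
  congr 1
  refine Finset.sum_equiv (cliffordPerm m g) (fun h => ?_) fun h _ => adjointRep_ketTriple g a h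
  have h0 : cliffordPerm m g h ≠ 0 ↔ h ≠ 0 := by
    rw [← cliffordPerm_zero g, (cliffordPerm m g).injective.ne_iff, cliffordPerm_zero]
  simp only [Finset.mem_filter, Finset.mem_univ, true_and, symp_cliffordPerm, h0,
    (cliffordPerm m g).injective.ne_iff]

theorem linearIndependent_of_functionals {X M : Type} [Fintype X] [AddCommGroup M] [Module ℂ M]
    {v : X → M} (ℓ : X → M →ₗ[ℂ] ℂ) (h0 : ∀ x y, y ≠ x → ℓ x (v y) = 0)
    (h1 : ∀ x, ℓ x (v x) ≠ 0) : LinearIndependent ℂ v := by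
  rw [Fintype.linearIndependent_iff]
  intro c hc x
  have h := congrArg (ℓ x) hc
  rw [map_sum, map_zero, Finset.sum_eq_single x (fun y _ hy => by rw [map_smul, h0 x y hy,
    smul_zero]) (fun hx => absurd (Finset.mem_univ x) hx), map_smul, smul_eq_mul] at h
  exact (mul_eq_zero.mp h).resolve_right (h1 x)

/-- The functional `Y ↦ tr ((A₁ ⊗ ⋯ ⊗ A_t) Y)`. -/
noncomputable def tracePairing {t : ℕ} (A : Fin t → Matrix (Qubits m) (Qubits m) ℂ) :
    CopyOp m t →ₗ[ℂ] ℂ :=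
  Matrix.traceLinearMap _ ℂ ℂ ∘ₗ LinearMap.mulLeft ℂ (tensorMat A)

theorem tracePairing_normTensor {t : ℕ} (A B : Fin t → Matrix (Qubits m) (Qubits m) ℂ) :
    tracePairing A (normTensor B) =
      (((Real.sqrt (((2 : ℝ) ^ m) ^ t))⁻¹ : ℝ) : ℂ) * ∏ j, (A j * B j).trace := by
  change (tensorMat A * normTensor B).trace = _
  rw [normTensor, Matrix.mul_smul, Matrix.trace_smul, ← tensorMat_mul, trace_tensorMat,
    smul_eq_mul]

theorem normFactor_ne_zero (m t : ℕ) :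
    (((Real.sqrt (((2 : ℝ) ^ m) ^ t))⁻¹ : ℝ) : ℂ) ≠ 0 := by
  rw [Complex.ofReal_ne_zero]
  positivity

theorem linearIndependent_ketPair :
    LinearIndependent ℂ fun x : NonzeroLabel m => ketPair x.1 := by
  refine linearIndependent_of_functionals
    (fun x => tracePairing ![pauli x.1, pauli x.1]) (fun x y hyx => ?_) fun x => ?_
  · rw [ketPair, tracePairing_normTensor, Fin.prod_univ_two]
    simp [trace_pauli_mul_of_ne (Subtype.coe_injective.ne hyx.symm)]
  · rw [ketPair, tracePairing_normTensor, Fin.prod_univ_two]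
    refine mul_ne_zero (normFactor_ne_zero m 2) ?_
    simp [Matrix.trace_one]

theorem exists_commuting_label (hm : 2 ≤ m) {a : PauliLabel m} (ha : a ≠ 0) :
    ∃ k : PauliLabel m, symp k a = 0 ∧ k ≠ 0 ∧ k ≠ a := by
  by_contra hcon
  push Not at hcon
  have hcard : (Finset.univ.filter fun k : PauliLabel m => symp k a = 0).card ≤ 2 := by
    refine (Finset.card_le_card (t := {0, a}) fun k hk => ?_).trans Finset.card_le_two
    rw [Finset.mem_insert, Finset.mem_singleton]
    by_cases h0 : k = 0
    · exact Or.inl h0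
    · exact Or.inr (hcon k (Finset.mem_filter.mp hk).2 h0)
  have hsum := sum_signChar_symp_of_ne_zero ha
  have hsplit : ∑ k, (1 + signChar (symp a k)) =
      2 * ((Finset.univ.filter fun k : PauliLabel m => symp k a = 0).card : ℂ) := by
    rw [Finset.card_eq_sum_ones, Finset.sum_filter, Nat.cast_sum, Finset.mul_sum]
    refine Finset.sum_congr rfl fun k _ => ?_
    rw [symp_comm a k]
    rcases zmod_two_cases (symp k a) with h | h <;> simp [h]
    norm_num
  rw [Finset.sum_add_distrib, hsum, add_zero] at hsplit
  simp only [Finset.sum_const, Finset.card_univ, nsmul_eq_mul, mul_one] at hsplit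
  have hnat : Fintype.card (PauliLabel m) =
      2 * (Finset.univ.filter fun k : PauliLabel m => symp k a = 0).card := by
    exact_mod_cast hsplit
  have hbig : 2 ^ 4 ≤ Fintype.card (PauliLabel m) := by
    simp only [Fintype.card_fun, ZMod.card, Fintype.card_sum, Fintype.card_fin]
    exact Nat.pow_le_pow_right (by norm_num) (by omega)
  omega

theorem tracePairing_ketTriple (c k a h : PauliLabel m) :
    tracePairing ![pauli c, pauli k, pauli k * pauli c] (ketTriple a h) =
      Complex.I ^ (symp a h).val * ((((Real.sqrt (((2 : ℝ) ^ m) ^ 3))⁻¹ : ℝ) : ℂ) *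
        ((pauli c * pauli a).trace * (pauli k * pauli h).trace *
          (pauli k * pauli c * (pauli a * pauli h)).trace)) := by
  rw [ketTriple, map_smul, tracePairing_normTensor, Fin.prod_univ_three]
  rfl

theorem linearIndependent_ketBar (hm : 2 ≤ m) :
    LinearIndependent ℂ fun x : NonzeroLabel m => ketBar x.1 := by
  choose k hk0 hk1 hk2 using fun x : NonzeroLabel m => exists_commuting_label hm x.2
  refine linearIndependent_of_functionals
    (fun x => tracePairing ![pauli x.1, pauli (k x), pauli (k x) * pauli x.1])
    (fun x y hyx => ?_) fun x => ?_
  · rw [ketBar, map_smul, map_sum]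
    rw [Finset.sum_eq_zero, smul_zero]
    intro h _
    rw [tracePairing_ketTriple, trace_pauli_mul_of_ne (Subtype.coe_injective.ne hyx.symm)]
    ring
  · rw [ketBar, map_smul, map_sum, Finset.sum_eq_single (k x)]
    · rw [tracePairing_ketTriple, Matrix.mul_assoc, ← Matrix.mul_assoc (pauli x.1) (pauli x.1),
        pauli_mul_self, Matrix.one_mul, pauli_mul_self, smul_eq_mul]
      have hsq : ((Real.sqrt (2 / (2 : ℝ) ^ m) : ℝ) : ℂ) ≠ 0 := by
        rw [Complex.ofReal_ne_zero]
        positivity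
      have htr : (1 : Matrix (Qubits m) (Qubits m) ℂ).trace ≠ 0 := by simp [Matrix.trace_one]
      exact mul_ne_zero hsq (mul_ne_zero (pow_ne_zero _ Complex.I_ne_zero)
        (mul_ne_zero (normFactor_ne_zero m 3) (mul_ne_zero (mul_ne_zero htr htr) htr)))
    · intro h _ hne
      rw [tracePairing_ketTriple, trace_pauli_mul_of_ne hne.symm]
      ring
    · intro hnot
      exact absurd (Finset.mem_filter.mpr ⟨Finset.mem_univ _, hk0 x, hk1 x, hk2 x⟩) hnot

theorem diagonalSector_eq_range :
    diagonalSector m = LinearMap.range (combination fun x : NonzeroLabel m => ketPair x.1) := by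
  rw [range_combination, diagonalSector]
  congr 1
  ext y
  constructor
  · rintro ⟨a, ha, rfl⟩
    exact ⟨⟨a, ha⟩, rfl⟩
  · rintro ⟨x, rfl⟩
    exact ⟨x.1, x.2, rfl⟩

theorem commutingDiagonal_eq_range :
    commutingDiagonal m = LinearMap.range (combination fun x : NonzeroLabel m => ketBar x.1) := by
  rw [range_combination, commutingDiagonal]
  congr 1
  ext y
  constructor
  · rintro ⟨a, ha, rfl⟩
    exact ⟨⟨a, ha⟩, rfl⟩
  · rintro ⟨x, rfl⟩
    exact ⟨x.1, x.2, rfl⟩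

theorem commutingDiagonal_le_commutingSector : commutingDiagonal m ≤ commutingSector m := by
  refine Submodule.span_le.mpr ?_
  rintro _ ⟨a, ha, rfl⟩
  refine Submodule.smul_mem _ _ (Submodule.sum_mem _ fun h hh => ?_)
  obtain ⟨-, h0, h1, h2⟩ := Finset.mem_filter.mp hh
  exact Submodule.subset_span ⟨a, h, ha, h1, (symp_comm a h).trans h0, h2.symm, rfl⟩

theorem combination_ketPair_permRep (g : cliffordGroup m)
    (f : EuclideanSpace ℂ (NonzeroLabel m)) :
    combination (fun x : NonzeroLabel m => ketPair x.1) (permRep (labelPerm m) g f) =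
      adjointRep m 2 g (combination (fun x : NonzeroLabel m => ketPair x.1) f) :=
  combination_permRep (fun g x => adjointRep_ketPair g x.1) g f

theorem combination_ketBar_permRep (g : cliffordGroup m)
    (f : EuclideanSpace ℂ (NonzeroLabel m)) :
    combination (fun x : NonzeroLabel m => ketBar x.1) (permRep (labelPerm m) g f) =
      adjointRep m 3 g (combination (fun x : NonzeroLabel m => ketBar x.1) f) :=
  combination_permRep (fun g x => adjointRep_ketBar g x.1) g f

theorem adjointRep_mem_diagonalSector (g : cliffordGroup m) ⦃x : CopyOp m 2⦄
    (hx : x ∈ diagonalSector m) : adjointRep m 2 g x ∈ diagonalSector m := by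
  rw [diagonalSector_eq_range] at hx ⊢
  obtain ⟨f, rfl⟩ := hx
  exact ⟨_, combination_ketPair_permRep g f⟩

theorem adjointRep_mem_commutingDiagonal (g : cliffordGroup m) ⦃x : CopyOp m 3⦄
    (hx : x ∈ commutingDiagonal m) : adjointRep m 3 g x ∈ commutingDiagonal m := by
  rw [commutingDiagonal_eq_range] at hx ⊢
  obtain ⟨f, rfl⟩ := hx
  exact ⟨_, combination_ketBar_permRep g f⟩

/-- Coordinates on the diagonal sector in the basis `|a, a⟩`. -/
noncomputable def diagonalCoord (m : ℕ) :
    EuclideanSpace ℂ (NonzeroLabel m) ≃ₗ[ℂ] diagonalSector m :=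
  (LinearEquiv.ofInjective _ (combination_injective linearIndependent_ketPair)).trans
    (LinearEquiv.ofEq _ _ diagonalSector_eq_range.symm)

/-- Coordinates on `V_d^{(c)}` in the basis `|ā⟩`. -/
noncomputable def barCoord (hm : 2 ≤ m) :
    EuclideanSpace ℂ (NonzeroLabel m) ≃ₗ[ℂ] commutingDiagonal m :=
  (LinearEquiv.ofInjective _ (combination_injective (linearIndependent_ketBar hm))).trans
    (LinearEquiv.ofEq _ _ commutingDiagonal_eq_range.symm)

theorem barCoord_apply (hm : 2 ≤ m) (f : EuclideanSpace ℂ (NonzeroLabel m)) :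
    (barCoord hm f : CopyOp m 3) = combination (fun x => ketBar x.1) f := rfl

/-- The isomorphism of representations `|a, a⟩ ↦ |ā⟩`. -/
noncomputable def sectorEquiv (hm : 2 ≤ m) :
    (Subrepresentation.mk (ρ := adjointRep m 2) (diagonalSector m)
      adjointRep_mem_diagonalSector).toRepresentation.Equiv
    (Subrepresentation.mk (ρ := adjointRep m 3) (commutingDiagonal m)
      adjointRep_mem_commutingDiagonal).toRepresentation :=
  Representation.Equiv.mk ((diagonalCoord m).symm.trans (barCoord hm)) fun g => by
    ext1 y
    obtain ⟨f, rfl⟩ := (diagonalCoord m).surjective y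
    have h : (Subrepresentation.mk (ρ := adjointRep m 2) (diagonalSector m)
        adjointRep_mem_diagonalSector).toRepresentation g (diagonalCoord m f) =
        diagonalCoord m (permRep (labelPerm m) g f) :=
      Subtype.ext (combination_ketPair_permRep g f).symm
    simp only [LinearMap.comp_apply, LinearEquiv.coe_coe]
    rw [h]
    simp only [LinearEquiv.trans_apply, LinearEquiv.symm_apply_apply]
    exact Subtype.ext (combination_ketBar_permRep g f)

theorem sectorEquiv_ketPair (hm : 2 ≤ m) (a : PauliLabel m) (ha : a ≠ 0) :
    (sectorEquiv hm ⟨ketPair a, ketPair_mem_diagonalSector ha⟩ : CopyOp m 3) = ketBar a := by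
  have h : (⟨ketPair a, ketPair_mem_diagonalSector ha⟩ : diagonalSector m) =
      diagonalCoord m (EuclideanSpace.single ⟨a, ha⟩ 1) :=
    Subtype.ext (combination_single (fun x : NonzeroLabel m => ketPair x.1) ⟨a, ha⟩).symm
  rw [h]
  change (barCoord hm ((diagonalCoord m).symm (diagonalCoord m _)) : CopyOp m 3) = _
  rw [LinearEquiv.symm_apply_apply, barCoord_apply, combination_single]

end Sectors

theorem theorem5 (m : ℕ) (hm : 2 ≤ m) :
    commutingDiagonal m ≤ commutingSector m ∧
    ∃ (hD : ∀ (g : cliffordGroup m) ⦃x : CopyOp m 2⦄,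
          x ∈ diagonalSector m → adjointRep m 2 g x ∈ diagonalSector m)
      (hV : ∀ (g : cliffordGroup m) ⦃x : CopyOp m 3⦄,
          x ∈ commutingDiagonal m → adjointRep m 3 g x ∈ commutingDiagonal m),
      (∃ L : (Subrepresentation.mk (ρ := adjointRep m 2) (diagonalSector m) hD).toRepresentation.Equiv
            (Subrepresentation.mk (ρ := adjointRep m 3) (commutingDiagonal m) hV).toRepresentation,
          ∀ (a : PauliLabel m) (ha : a ≠ 0),
            (L ⟨ketPair a, ketPair_mem_diagonalSector ha⟩ : CopyOp m 3) = ketBar a) ∧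
      (∃ W : Fin 3 → Subrepresentation (adjointRep m 3),
          (∀ i, (W i).toRepresentation.IsIrreducible) ∧
          (∀ i j, i ≠ j →
            IsEmpty ((W i).toRepresentation.Equiv (W j).toRepresentation)) ∧
          iSupIndep (fun i => (W i).toSubmodule) ∧
          ⨆ i, (W i).toSubmodule = commutingDiagonal m) := by
  have hinj := combination_injective (linearIndependent_ketBar hm)
  have hindep : iSupIndep fun i => Module.End.eigenspace (signOp m) (signEigenvalue m i) :=
    (Module.End.eigenspaces_iSupIndep (signOp m)).comp (signEigenvalue_injective hm)
  refine ⟨commutingDiagonal_le_commutingSector, adjointRep_mem_diagonalSector,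
    adjointRep_mem_commutingDiagonal, ⟨sectorEquiv hm, sectorEquiv_ketPair hm⟩,
    fun i => mapSubrep (π := permRep (labelPerm m)) _ combination_ketBar_permRep
      (Module.End.eigenspace (signOp m) (signEigenvalue m i)) (eigenspace_permRep_mem _),
    fun i => ?_, fun i j hij => ?_, ?_, ?_⟩
  · exact mapSubrep_isIrreducible (permRep_inner _) hinj _ (intertwiner_scalar_on_eigenspace _) _
      (eigenspace_ne_bot hm i)
  · exact mapSubrep_isEmpty_equiv (permRep_inner _) hinj _ (intertwiner_scalar_on_eigenspace _) _ _
      (hindep.pairwiseDisjoint hij) (eigenspace_ne_bot hm i)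
  · exact LinearMap.iSupIndep_map _ hinj hindep
  · change ⨆ i, Submodule.map (combination fun x : NonzeroLabel m => ketBar x.1)
      (Module.End.eigenspace (signOp m) (signEigenvalue m i)) = _
    rw [← Submodule.map_iSup, iSup_eigenspace hm, Submodule.map_top, commutingDiagonal_eq_range]
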